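/- Let $n\ge 0$ be an integer, $T>0$, let $H_0,H_1$ be traceless skew-Hermitian complex $n\times n$ matrices, and let $\rho_0,\theta$ be Hermitian $n\times n$ matrices. Put $\mathcal H=L^2([0,T],\mathbb R)$. For $u\in\mathcal H$ let $\rho:[0,T]\to\mathbb C^{n\times n}$ be the (Carathéodory) solution of $$\dot\rho(t)=[H_0+u(t)H_1,\rho(t)],\qquad \rho(0)=\rho_0,$$ and put $\mathrm{End}(u)=\rho(T)$. Let $\mathcal O(\rho_0)=\{U\rho_0U^\dagger: U\in \mathrm{SU}(n)\}$ and $N=\dim\mathcal O(\rho_0)$, that is, the real dimension of the tangent space of $\mathcal O(\rho_0)$ at $\rho_0$. Put $J(\rho)=\mathrm{Re}\,\mathrm{tr}(\rho\theta)$ for $\rho\in\mathcal O(\rho_0)$ and $\mathcal J(u)=J(\mathrm{End}(u))$ for $u\in\mathcal H$. The solution $\rho$ exists and $\rho(T)$ is uniquely determined for every $u \in \mathcal H$, and $\mathrm{End}$ is a $C^\infty$ map from $\mathcal H$ to $\mathbb C^{n\times n}$ with values in $\mathcal O(\rho_0)$; this is part of the claim. Assume (H1) $\rho_0$ and $\theta$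 both have simple eigenvalues; (H2) every control $u\in\mathcal H$ is regular: the rank of the differential $d\mathrm{End}(u)$ equals $N$. Then the function $J$ on $\mathcal O(\rho_0)$ has exactly $n!$ critical points. List them as $\rho_1,\dots,\rho_{n!}$ with $J(\rho_1)\le\dots\le J(\rho_{n!})$, and put $\mathcal H_i=\{u\in\mathcal H:\mathrm{End}(u)=\rho_i\}$. The following hold. (i) The set of critical points of $\mathcal J$ is the disjoint union of the sets $\mathcal H_i$, $i=1,\dots,n!$. (ii) Each $\mathcal H_i$ is a smooth submanifold of $\mathcal H$ of codimension $N$. (iii) For each $i$ and each $u\in\mathcal H_i$, the tangent space $T_u\mathcal H_i$ is $\ker d\mathrm{End}(u)$. -/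

import Mathlib

open MeasureTheory
open scoped ContDiff Matrix

/- Matrices carry the `L²` operator norm. All norms on this finite-dimensional space are
equivalent, so continuity, integrals and derivatives do not depend on the choice. -/
open scoped Matrix.Norms.L2Operator

noncomputable section

namespace QuantumControl

/-! ### Submanifolds of normed spaces -/

section Submanifold

variable {E : Type*} [NormedAddCommGroup E] [NormedSpace ℝ E]

/-- `S` is a smooth (embedded) submanifold of `E` of codimension `N`: around each of its points
there is a smooth diffeomorphism `φ` from an open subset of `E` onto an open subset of a product
`ℝᴺ × K`, where `K` is a closed subspace of `E`, which carries `S` to the slice `{0} × K`. -/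
def IsSubmanifoldOfCodim (N : ℕ) (S : Set E) : Prop :=
  ∀ x ∈ S, ∃ (K : Submodule ℝ E) (φ : OpenPartialHomeomorph E (EuclideanSpace ℝ (Fin N) × K)),
    IsClosed (K : Set E) ∧ x ∈ φ.source ∧
    ContDiffOn ℝ ∞ φ φ.source ∧ ContDiffOn ℝ ∞ φ.symm φ.target ∧
    ∀ y ∈ φ.source, (y ∈ S ↔ (φ y).1 = 0)

/-- The tangent vectors to `S` at `x`: the velocities at time `0` of the smooth curves
`γ : (-ε, ε) → S` with `γ 0 = x`. -/
def tangentVectors (S : Set E) (x : E) : Set E :=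
  {v | ∃ ε > (0 : ℝ), ∃ γ : ℝ → E, ContDiffOn ℝ ∞ γ (Set.Ioo (-ε) ε) ∧
    (∀ t ∈ Set.Ioo (-ε) ε, γ t ∈ S) ∧ γ 0 = x ∧ HasDerivAt γ v 0}

/-- The critical points of the restriction of the function `f` to `S`: the points of `S` at which
the differential of `f` vanishes on the tangent space of `S`. -/
def criticalPointsOn (f : E → ℝ) (S : Set E) : Set E :=
  {x | x ∈ S ∧ DifferentiableAt ℝ f x ∧ ∀ v ∈ tangentVectors S x, fderiv ℝ f x v = 0}

/-- The critical points of a function on the whole space: its Fréchet derivative exists and is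
zero. -/
def criticalPoints (f : E → ℝ) : Set E :=
  {x | HasFDerivAt f (0 : E →L[ℝ] ℝ) x}

end Submanifold

/-! ### The controlled Liouville–von Neumann equation -/

variable {n : ℕ}

/-- The unitary orbit `𝒪(ρ₀) = {U ρ₀ U† : U ∈ SU(n)}`. -/
def unitaryOrbit (ρ₀ : Matrix (Fin n) (Fin n) ℂ) : Set (Matrix (Fin n) (Fin n) ℂ) :=
  {A | ∃ U ∈ Matrix.specialUnitaryGroup (Fin n) ℂ, A = U * ρ₀ * Uᴴ}

/-- The dimension `N` of the orbit `𝒪(ρ₀)`: the real dimension of its tangent space at `ρ₀`. -/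
def orbitDim (ρ₀ : Matrix (Fin n) (Fin n) ℂ) : ℕ :=
  Module.finrank ℝ (Submodule.span ℝ (tangentVectors (unitaryOrbit ρ₀) ρ₀))

/-- The control space `L²([0,T], ℝ)`. -/
abbrev Control (T : ℝ) : Type := Lp ℝ 2 (volume.restrict (Set.Icc (0 : ℝ) T))

/-- `ρ` is the trajectory on `[0,T]` of `ρ' = [H₀ + u(t) H₁, ρ]`, `ρ(0) = ρ₀`, in the
Carathéodory sense: it is continuous and satisfies the integrated equation. -/
def IsTrajectory (H₀ H₁ ρ₀ : Matrix (Fin n) (Fin n) ℂ) (T : ℝ) (u : Control T)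
    (ρ : ℝ → Matrix (Fin n) (Fin n) ℂ) : Prop :=
  ContinuousOn ρ (Set.Icc 0 T) ∧
  ∀ t ∈ Set.Icc (0 : ℝ) T,
    ρ t = ρ₀ + ∫ s in (0 : ℝ)..t, ((H₀ + u s • H₁) * ρ s - ρ s * (H₀ + u s • H₁))

open Classical in
/-- The end-point map `u ↦ ρ(T)`, where `ρ` is the trajectory of the control `u`. -/
def endPoint (H₀ H₁ ρ₀ : Matrix (Fin n) (Fin n) ℂ) (T : ℝ) (u : Control T) :
    Matrix (Fin n) (Fin n) ℂ :=
  if h : ∃ ρ, IsTrajectory H₀ H₁ ρ₀ T u ρ then h.choose T else ρ₀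

/-- The cost `J(ρ) = Re tr(ρ θ)`. -/
def cost (θ ρ : Matrix (Fin n) (Fin n) ℂ) : ℝ := (Matrix.trace (ρ * θ)).re

/-- The cost `𝒥(u) = J(End(u))` on the control space. -/
def controlCost (H₀ H₁ ρ₀ θ : Matrix (Fin n) (Fin n) ℂ) (T : ℝ) (u : Control T) : ℝ :=
  cost θ (endPoint H₀ H₁ ρ₀ T u)

/-- The control `u` is regular: the rank of the differential of the end-point map at `u` is the
dimension of the orbit. -/
def IsRegularControl (H₀ H₁ ρ₀ : Matrix (Fin n) (Fin n) ℂ) (T : ℝ) (u : Control T) : Prop :=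
  Module.finrank ℝ (LinearMap.range (fderiv ℝ (endPoint H₀ H₁ ρ₀ T) u).toLinearMap)
    = orbitDim ρ₀

/-- The fibre `{u : End(u) = σ}` of the end-point map. -/
def fibre (H₀ H₁ ρ₀ : Matrix (Fin n) (Fin n) ℂ) (T : ℝ) (σ : Matrix (Fin n) (Fin n) ℂ) :
    Set (Control T) :=
  {u | endPoint H₀ H₁ ρ₀ T u = σ}

end QuantumControl

end

open QuantumControl

/-!
Write `P f = ∫₀ᵗ [H₀ + u H₁, f] ds` on `C([0, T], ℂⁿˣⁿ)`, so that a trajectory is a solution of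
`(1 - P) ρ = ρ₀`. Being of Volterra type, `P` has a power of norm less than `1`, hence `1 - P` is
invertible, and its inverse depends smoothly on `u` because `P` is affine in `u`. For continuous
controls the trajectory is `X ρ₀ X†` with `X` unitary; this passes to all of `L²` by density.

The differential of the end-point map takes values in the tangent space of the orbit, so at a
regular control its range is that whole tangent space. This identifies the critical points of the
pulled-back cost, and since the rank is everywhere at most `N`, a rank-`N` point has a
neighbourhood of constant rank, where the fibre is a submanifold.

A critical point `ρ` of the cost commutes with `θ`: test with the tangent vector `[[ρ, θ], ρ]`.
Conversely, if `ρ` commutes with `θ` then `θ` is a polynomial in `ρ`, because `ρ` has simple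
spectrum, and `tr (p(ρ) v) = 0` for tangent `v`, because the traces of powers are constant on the
orbit. Since `θ` has simple spectrum, the critical points are thus the `n!` matrices which are
diagonal in its eigenbasis with the eigenvalues of `ρ₀` in some order.
-/

namespace QuantumControl

open Topology

section SliceChart

variable {E G K : Type*} [NormedAddCommGroup E] [NormedSpace ℝ E]
  [NormedAddCommGroup G] [NormedSpace ℝ G] [NormedAddCommGroup K] [NormedSpace ℝ K]

/-- The local homeomorphism `φ` from `E` to `G × K` is a smooth diffeomorphism that straightens the
set `S` to the slice `{0} × K`. -/
structure IsSliceChart (φ : OpenPartialHomeomorph E (G × K)) (S : Set E) : Prop where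
  contDiffOn : ContDiffOn ℝ ∞ φ φ.source
  contDiffOn_symm : ContDiffOn ℝ ∞ φ.symm φ.target
  mem_iff : ∀ y ∈ φ.source, y ∈ S ↔ (φ y).1 = 0

namespace IsSliceChart

variable {φ : OpenPartialHomeomorph E (G × K)} {S : Set E} {x v : E}

theorem hasFDerivAt (h : IsSliceChart φ S) (hx : x ∈ φ.source) :
    HasFDerivAt φ (fderiv ℝ φ x) x :=
  ((h.contDiffOn.contDiffAt (φ.open_source.mem_nhds hx)).differentiableAt (by simp)).hasFDerivAt

theorem hasFDerivAt_symm (h : IsSliceChart φ S) (hx : x ∈ φ.source) :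
    HasFDerivAt φ.symm (fderiv ℝ φ.symm (φ x)) (φ x) :=
  ((h.contDiffOn_symm.contDiffAt (φ.open_target.mem_nhds (φ.map_source hx))).differentiableAt
    (by simp)).hasFDerivAt

theorem fderiv_symm_apply_fderiv (h : IsSliceChart φ S) (hx : x ∈ φ.source) :
    fderiv ℝ φ.symm (φ x) (fderiv ℝ φ x v) = v := by
  have hcomp : HasFDerivAt (φ.symm ∘ φ) ((fderiv ℝ φ.symm (φ x)).comp (fderiv ℝ φ x)) x :=
    (h.hasFDerivAt_symm hx).comp x (h.hasFDerivAt hx)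
  have hid : HasFDerivAt (φ.symm ∘ φ) (ContinuousLinearMap.id ℝ E) x :=
    (hasFDerivAt_id x).congr_of_eventuallyEq (φ.eventually_left_inverse hx)
  exact DFunLike.congr_fun (hcomp.unique hid) v

theorem fst_fderiv_eq_zero_of_mem_tangentVectors (h : IsSliceChart φ S) (hx : x ∈ φ.source)
    (hv : v ∈ tangentVectors S x) : (fderiv ℝ φ x v).1 = 0 := by
  obtain ⟨ε, hε, γ, -, hγS, rfl, hγ⟩ := hv
  have hfst : HasDerivAt (fun t => (φ (γ t)).1) (fderiv ℝ φ (γ 0) v).1 0 :=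
    ((h.hasFDerivAt hx).comp_hasDerivAt (0 : ℝ) hγ).fst
  have hzero : (fun t => (φ (γ t)).1) =ᶠ[𝓝 0] fun _ => 0 := by
    filter_upwards [Ioo_mem_nhds (neg_lt_zero.2 hε) hε,
      hγ.continuousAt.preimage_mem_nhds (φ.open_source.mem_nhds hx)] with t ht hts
    exact (h.mem_iff _ hts).1 (hγS t ht)
  exact hfst.unique ((hasDerivAt_const _ _).congr_of_eventuallyEq hzero)

theorem mem_tangentVectors_of_fst_fderiv_eq_zero (h : IsSliceChart φ S) (hxS : x ∈ S)
    (hx : x ∈ φ.source) (hv : (fderiv ℝ φ x v).1 = 0) : v ∈ tangentVectors S x := by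
  let line : ℝ → G × K := fun t => φ x + t • fderiv ℝ φ x v
  have hline0 : line 0 = φ x := by simp [line]
  have hline : HasDerivAt line (fderiv ℝ φ x v) 0 := by
    simpa only [one_smul, id_eq] using
      ((hasDerivAt_id (0 : ℝ)).smul_const (fderiv ℝ φ x v)).const_add (φ x)
  obtain ⟨ε, hε, hball⟩ := Metric.eventually_nhds_iff_ball.1
    (hline.continuousAt.eventually_mem
      (φ.open_target.mem_nhds (hline0.symm ▸ φ.map_source hx)))
  have htarget : Set.MapsTo line (Set.Ioo (-ε) ε) φ.target := fun t ht =>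
    hball t (by simpa [Real.ball_eq_Ioo] using ht)
  refine ⟨ε, hε, φ.symm ∘ line, h.contDiffOn_symm.comp (by fun_prop) htarget, fun t ht => ?_,
    by simp [hline0, hx], ?_⟩
  · rw [Function.comp_apply, h.mem_iff _ (φ.map_target (htarget ht)), φ.right_inv (htarget ht)]
    simp [line, hv, (h.mem_iff x hx).1 hxS]
  · have hsymm := h.hasFDerivAt_symm hx
    rw [← hline0] at hsymm
    simpa only [hline0, h.fderiv_symm_apply_fderiv hx] using hsymm.comp_hasDerivAt (0 : ℝ) hline

theorem tangentVectors_eq (h : IsSliceChart φ S) (hxS : x ∈ S) (hx : x ∈ φ.source) :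
    tangentVectors S x = {v | (fderiv ℝ φ x v).1 = 0} :=
  Set.ext fun _ => ⟨h.fst_fderiv_eq_zero_of_mem_tangentVectors hx,
    h.mem_tangentVectors_of_fst_fderiv_eq_zero hxS hx⟩

end IsSliceChart

end SliceChart

section RankTheorem

variable {E F G : Type*} [NormedAddCommGroup E] [NormedSpace ℝ E]
  [NormedAddCommGroup F] [NormedSpace ℝ F] [NormedAddCommGroup G] [NormedSpace ℝ G]

theorem ker_comp_le_ker_of_surjective {𝕜 V W U : Type*} [Field 𝕜] [AddCommGroup V] [Module 𝕜 V]
    [AddCommGroup W] [Module 𝕜 W] [AddCommGroup U] [Module 𝕜 U] [FiniteDimensional 𝕜 U]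
    {A : V →ₗ[𝕜] W} [FiniteDimensional 𝕜 A.range] {p : W →ₗ[𝕜] U}
    (hle : Module.finrank 𝕜 A.range ≤ Module.finrank 𝕜 U) (hsurj : Function.Surjective (p ∘ₗ A)) :
    (p ∘ₗ A).ker ≤ A.ker := by
  have hsurj' : Function.Surjective (p.domRestrict A.range) := fun w => by
    obtain ⟨v, hv⟩ := hsurj w
    exact ⟨⟨A v, v, rfl⟩, hv⟩
  have heq : Module.finrank 𝕜 A.range = Module.finrank 𝕜 U :=
    hle.antisymm (LinearMap.finrank_le_finrank_of_surjective hsurj')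
  have hinj : Function.Injective (p.domRestrict A.range) :=
    (LinearMap.injective_iff_surjective_of_finrank_eq_finrank heq).2 hsurj'
  intro v hv
  have hAv : (⟨A v, v, rfl⟩ : A.range) = 0 := hinj (by rw [map_zero]; exact hv)
  exact congrArg Subtype.val hAv

theorem eq_of_fst_eq_of_finrank_range_le {K : Type*} [NormedAddCommGroup K] [NormedSpace ℝ K]
    [FiniteDimensional ℝ F] [FiniteDimensional ℝ G] {h : G × K → F} {p : F →L[ℝ] G}
    {B : Set (G × K)} (hBo : IsOpen B) (hBc : Convex ℝ B) (hd : DifferentiableOn ℝ h B)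
    (hp : ∀ y ∈ B, p (h y) = y.1)
    (hrank : ∀ y ∈ B, Module.finrank ℝ (fderiv ℝ h y).range ≤ Module.finrank ℝ G)
    {a : G} {k₁ k₂ : K} (hk₁ : (a, k₁) ∈ B) (hk₂ : (a, k₂) ∈ B) : h (a, k₁) = h (a, k₂) := by
  have hfd : ∀ y ∈ B, HasFDerivAt h (fderiv ℝ h y) y := fun y hy =>
    (hd.differentiableAt (hBo.mem_nhds hy)).hasFDerivAt
  have hp' : ∀ y ∈ B, ∀ w, p (fderiv ℝ h y w) = w.1 := fun y hy w =>
    DFunLike.congr_fun ((p.hasFDerivAt.comp y (hfd y hy)).unique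
      (hasFDerivAt_fst.congr_of_eventuallyEq
      (Filter.eventually_of_mem (hBo.mem_nhds hy) hp))) w
  have hvert : ∀ y ∈ B, ∀ k : K, fderiv ℝ h y (0, k) = 0 := fun y hy k =>
    ker_comp_le_ker_of_surjective (A := (fderiv ℝ h y).toLinearMap) (p := p.toLinearMap)
      (hrank y hy) (fun w => ⟨(w, 0), hp' y hy (w, 0)⟩) (hp' y hy (0, k))
  have hslice : ∀ k ∈ Prod.mk a ⁻¹' B, HasFDerivAt (fun k => h (a, k)) (0 : K →L[ℝ] F) k :=
    fun k hk => ((hfd _ hk).comp k (hasFDerivAt_prodMk_right a k)).congr_fderiv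
      (ContinuousLinearMap.ext (hvert _ hk))
  have hopen : IsOpen (Prod.mk a ⁻¹' B) := hBo.preimage (by fun_prop)
  have hconv : Convex ℝ (Prod.mk a ⁻¹' B) := fun k hk k' hk' s t hs ht hst => by
    simpa [← add_smul, hst] using hBc hk hk' hs ht hst
  exact hconv.is_const_of_fderivWithin_eq_zero (𝕜 := ℝ)
    (fun k hk => (hslice k hk).differentiableAt.differentiableWithinAt)
    (fun k hk => by rw [fderivWithin_of_isOpen hopen hk, (hslice k hk).fderiv]) hk₁ hk₂

theorem eq_of_fst_chart_eq {K : Type*} [NormedAddCommGroup K] [NormedSpace ℝ K]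
    [FiniteDimensional ℝ F] [FiniteDimensional ℝ G] {f : E → F} (hf : ContDiff ℝ ∞ f)
    (hle : ∀ x, Module.finrank ℝ (fderiv ℝ f x).range ≤ Module.finrank ℝ G)
    {φ : OpenPartialHomeomorph E (G × K)} (hconv : Convex ℝ φ.target)
    (hφ : ContDiffOn ℝ ∞ φ.symm φ.target) {p : F →L[ℝ] G} {c : F}
    (hp : ∀ y ∈ φ.source, p (f y - c) = (φ y).1) {x y : E} (hx : x ∈ φ.source)
    (hy : y ∈ φ.source) (hxy : (φ x).1 = (φ y).1) : f x = f y := by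
  have hd : ∀ z ∈ φ.target, HasFDerivAt (fun z => f (φ.symm z) - c)
      ((fderiv ℝ f (φ.symm z)).comp (fderiv ℝ φ.symm z)) z := fun z hz =>
    ((hf.differentiable (by simp) _).hasFDerivAt.comp z
      (((hφ.contDiffAt (φ.open_target.mem_nhds hz)).differentiableAt
        (by simp)).hasFDerivAt)).sub_const c
  have hconst := eq_of_fst_eq_of_finrank_range_le (h := fun z => f (φ.symm z) - c) (p := p)
    φ.open_target hconv (fun z hz => (hd z hz).differentiableAt.differentiableWithinAt)
    (fun z hz => by rw [hp _ (φ.map_target hz), φ.right_inv hz])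
    (fun z hz => by
      rw [(hd z hz).fderiv]
      exact (Submodule.finrank_mono (LinearMap.range_comp_le_range _ _)).trans (hle _))
    (a := (φ x).1) (k₁ := (φ x).2) (k₂ := (φ y).2) (φ.map_source hx) (hxy ▸ φ.map_source hy)
  have hy' : ((φ x).1, (φ y).2) = φ y := Prod.ext hxy rfl
  simpa [hy', hx, hy] using hconst

theorem exists_comp_surjective_of_finrank_range_eq [FiniteDimensional ℝ F] {N : ℕ}
    {A : E →L[ℝ] F} (hA : Module.finrank ℝ A.range = N) :
    ∃ p : F →L[ℝ] EuclideanSpace ℝ (Fin N), Function.Surjective (p.comp A) := by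
  obtain ⟨r, hr⟩ := Submodule.ClosedComplemented.of_finiteDimensional A.range
  let i : A.range ≃L[ℝ] EuclideanSpace ℝ (Fin N) := ContinuousLinearEquiv.ofFinrankEq (by simp [hA])
  refine ⟨(i : A.range →L[ℝ] _).comp r, fun w => ?_⟩
  obtain ⟨v, hv⟩ := (i.symm w).2
  refine ⟨v, ?_⟩
  change i (r (A v)) = w
  rw [← i.apply_symm_apply w, ← hr (i.symm w), ← hv]
  rfl

variable [CompleteSpace E]

theorem exists_openPartialHomeomorph_convex_target {f : E → F} (hf : ContDiff ℝ ∞ f) {x₀ : E}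
    {e : E ≃L[ℝ] F} (he : HasFDerivAt f (e : E →L[ℝ] F) x₀) :
    ∃ φ : OpenPartialHomeomorph E F, ⇑φ = f ∧ x₀ ∈ φ.source ∧ Convex ℝ φ.target ∧
      ContDiffOn ℝ ∞ φ.symm φ.target := by
  let ψ := hf.contDiffAt.toOpenPartialHomeomorph f he (by simp)
  have hx₀ : x₀ ∈ ψ.source := hf.contDiffAt.mem_toOpenPartialHomeomorph_source he (by simp)
  have hinv : ∀ᶠ y in 𝓝 (f x₀), y ∈ ψ.target ∧ ∃ e' : E ≃L[ℝ] F, e' = fderiv ℝ f (ψ.symm y) := by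
    refine (ψ.open_target.eventually_mem (ψ.map_source hx₀)).and ?_
    have hcont : ContinuousAt (fun y => fderiv ℝ f (ψ.symm y)) (f x₀) :=
      (hf.continuous_fderiv (by simp)).continuousAt.comp
        (ψ.continuousAt_symm (ψ.map_source hx₀))
    have hψ : ψ.symm (f x₀) = x₀ := ψ.left_inv hx₀
    refine hcont.eventually_mem (s := Set.range ((↑) : (E ≃L[ℝ] F) → E →L[ℝ] F)) ?_
    rw [hψ, he.fderiv]
    exact ContinuousLinearEquiv.nhds e
  obtain ⟨ε, hε, hball⟩ := Metric.eventually_nhds_iff_ball.1 hinv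
  let φ := (ψ.symm.restrOpen (Metric.ball (f x₀) ε) Metric.isOpen_ball).symm
  have htarget : φ.target = Metric.ball (f x₀) ε :=
    Set.inter_eq_right.2 fun y hy => (hball y hy).1
  refine ⟨φ, rfl, ?_, ?_, ?_⟩
  · exact ⟨hx₀, by simpa [ψ] using hε⟩
  · exact htarget ▸ convex_ball _ _
  · intro y hy
    obtain ⟨hy', e', he'⟩ := hball y (htarget ▸ hy)
    refine (ψ.contDiffAt_symm hy' (f₀' := e') ?_ hf.contDiffAt).contDiffWithinAt
    rw [he']
    exact (hf.differentiable (by simp) _).hasFDerivAt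

theorem exists_submersion_chart [CompleteSpace G] {g : E → G} (hg : ContDiff ℝ ∞ g) {x₀ : E}
    (hsurj : (fderiv ℝ g x₀).range = ⊤) (hker : (fderiv ℝ g x₀).ker.ClosedComplemented) :
    ∃ φ : OpenPartialHomeomorph E (G × (fderiv ℝ g x₀).ker), x₀ ∈ φ.source ∧
      Convex ℝ φ.target ∧ ContDiff ℝ ∞ φ ∧ ContDiffOn ℝ ∞ φ.symm φ.target ∧
      ∀ y, (φ y).1 = g y := by
  have : CompleteSpace (fderiv ℝ g x₀).ker := (fderiv ℝ g x₀).isClosed_ker.completeSpace_coe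
  obtain ⟨P, hP⟩ := hker
  let f : E → G × (fderiv ℝ g x₀).ker := fun y => (g y, P y)
  have hf : ContDiff ℝ ∞ f := hg.prodMk P.contDiff
  let e := ContinuousLinearMap.equivProdOfSurjectiveOfIsCompl (fderiv ℝ g x₀) P hsurj
    (LinearMap.range_eq_of_proj hP) (LinearMap.isCompl_of_proj hP)
  have he : HasFDerivAt f (e : E →L[ℝ] G × (fderiv ℝ g x₀).ker) x₀ :=
    (hg.differentiable (by simp) x₀).hasFDerivAt.prodMk P.hasFDerivAt
  obtain ⟨φ, hφ, hx₀, hconv, hsymm⟩ := exists_openPartialHomeomorph_convex_target hf he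
  exact ⟨φ, hx₀, hconv, hφ ▸ hf, hsymm, fun y => by rw [hφ]⟩

variable [FiniteDimensional ℝ F] {N : ℕ} {f : E → F} {x₀ : E}

theorem exists_isSliceChart_fibre (hf : ContDiff ℝ ∞ f)
    (hle : ∀ x, Module.finrank ℝ (fderiv ℝ f x).range ≤ N)
    (hx₀ : Module.finrank ℝ (fderiv ℝ f x₀).range = N) :
    ∃ (K : Submodule ℝ E) (φ : OpenPartialHomeomorph E (EuclideanSpace ℝ (Fin N) × K)),
      IsClosed (K : Set E) ∧ x₀ ∈ φ.source ∧ IsSliceChart φ {y | f y = f x₀} ∧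
      ∀ v, (fderiv ℝ φ x₀ v).1 = 0 ↔ fderiv ℝ f x₀ v = 0 := by
  obtain ⟨p, hp⟩ := exists_comp_surjective_of_finrank_range_eq hx₀
  let g : E → EuclideanSpace ℝ (Fin N) := fun y => p (f y - f x₀)
  have hg : ContDiff ℝ ∞ g := p.contDiff.comp (hf.sub contDiff_const)
  have hg' : fderiv ℝ g x₀ = p.comp (fderiv ℝ f x₀) :=
    (p.hasFDerivAt.comp x₀
      ((hf.differentiable (by simp) x₀).hasFDerivAt.sub_const (f x₀))).fderiv
  obtain ⟨φ, hφx₀, hconv, hφ, hφsymm, hφg⟩ := exists_submersion_chart hg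
    (hg' ▸ LinearMap.range_eq_top.2 hp)
    (fderiv ℝ g x₀).ker_closedComplemented_of_finiteDimensional_range
  refine ⟨_, φ, (fderiv ℝ g x₀).isClosed_ker, hφx₀,
    ⟨hφ.contDiffOn, hφsymm, fun y hy => ⟨fun hyf => ?_, fun hyφ => ?_⟩⟩, fun v => ?_⟩
  · have hyf : f y = f x₀ := hyf
    simp [hφg, g, hyf]
  · exact eq_of_fst_chart_eq hf (by simpa using hle) hconv hφsymm (p := p) (c := f x₀)
      (fun z _ => (hφg z).symm) hy hφx₀ (by rw [hyφ, hφg]; simp [g])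
  · have hfst : (fderiv ℝ φ x₀ v).1 = p (fderiv ℝ f x₀ v) := by
      have hcomp : HasFDerivAt (fun y => (φ y).1) _ x₀ :=
        (hφ.differentiable (by simp) x₀).hasFDerivAt.fst
      rw [funext hφg] at hcomp
      exact DFunLike.congr_fun (hcomp.fderiv.symm.trans hg') v
    rw [hfst]
    exact ⟨fun hv => ker_comp_le_ker_of_surjective (A := (fderiv ℝ f x₀).toLinearMap)
      (p := p.toLinearMap) (by simp [hx₀]) hp hv, fun hv => by rw [hv, map_zero]⟩

theorem isSubmanifoldOfCodim_fibre_of_finrank_range_le {c : F} (hf : ContDiff ℝ ∞ f)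
    (hle : ∀ x, Module.finrank ℝ (fderiv ℝ f x).range ≤ N)
    (heq : ∀ x, f x = c → Module.finrank ℝ (fderiv ℝ f x).range = N) :
    IsSubmanifoldOfCodim N {x | f x = c} := by
  rintro x rfl
  obtain ⟨K, φ, hK, hx, hφ, -⟩ := exists_isSliceChart_fibre hf hle (heq x rfl)
  exact ⟨K, φ, hK, hx, hφ.contDiffOn, hφ.contDiffOn_symm, hφ.mem_iff⟩

theorem tangentVectors_fibre_of_finrank_range_le (hf : ContDiff ℝ ∞ f)
    (hle : ∀ x, Module.finrank ℝ (fderiv ℝ f x).range ≤ N)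
    (hx₀ : Module.finrank ℝ (fderiv ℝ f x₀).range = N) :
    tangentVectors {x | f x = f x₀} x₀ = {v | fderiv ℝ f x₀ v = 0} := by
  obtain ⟨K, φ, -, hx, hφ, hker⟩ := exists_isSliceChart_fibre hf hle hx₀
  exact (hφ.tangentVectors_eq rfl hx).trans (Set.ext hker)

end RankTheorem

section ControlPrimitive

theorem sq_integral_mul_norm_le {α V : Type*} [MeasurableSpace α] {μ : Measure α}
    [NormedAddCommGroup V] {a : α → ℝ} {b : α → V} (ha : MemLp a 2 μ) (hb : MemLp b 2 μ) :
    (∫ s, |a s| * ‖b s‖ ∂μ) ^ 2 ≤ (∫ s, a s ^ 2 ∂μ) * ∫ s, ‖b s‖ ^ 2 ∂μ := by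
  have h := integral_mul_le_Lp_mul_Lq_of_nonneg (μ := μ) Real.HolderConjugate.two_two
    (f := fun s => |a s|) (g := fun s => ‖b s‖) (.of_forall fun s => abs_nonneg _)
    (.of_forall fun s => norm_nonneg _) (by rw [ENNReal.ofReal_ofNat]; exact ha.abs)
    (by rw [ENNReal.ofReal_ofNat]; exact hb.norm)
  simp only [Real.rpow_two, sq_abs, ← Real.sqrt_eq_rpow] at h
  refine (pow_le_pow_left₀ (integral_nonneg fun s => by positivity) h 2).trans_eq ?_
  rw [mul_pow, Real.sq_sqrt (integral_nonneg fun s => by positivity),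
    Real.sq_sqrt (integral_nonneg fun s => by positivity)]

variable {T t : ℝ} {V : Type*} [NormedAddCommGroup V] [NormedSpace ℝ V]

theorem norm_sq_eq_integral_sq (u : Control T) : ‖u‖ ^ 2 = ∫ s in Set.Icc 0 T, u s ^ 2 := by
  have h := L2.inner_def (𝕜 := ℝ) u u
  rw [real_inner_self_eq_norm_sq] at h
  simpa [sq] using h

theorem integrableOn_control_smul (u : Control T) {g : ℝ → V} (hg : ContinuousOn g (Set.Icc 0 T)) :
    IntegrableOn (fun s => u s • g s) (Set.Icc 0 T) :=
  IntegrableOn.smul_continuousOn ((Lp.memLp u).integrable (by norm_num)) hg isCompact_Icc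

theorem intervalIntegrable_control_smul (u : Control T) {g : ℝ → V}
    (hg : ContinuousOn g (Set.Icc 0 T)) (ht : t ∈ Set.Icc 0 T) :
    IntervalIntegrable (fun s => u s • g s) volume 0 t := by
  rw [intervalIntegrable_iff_integrableOn_Icc_of_le ht.1]
  exact (integrableOn_control_smul u hg).mono_set (Set.Icc_subset_Icc_right ht.2)

theorem intervalIntegral_congr_of_ae_restrict_Icc {f g : ℝ → V} (ht : t ∈ Set.Icc 0 T)
    (h : ∀ᵐ s ∂(volume.restrict (Set.Icc 0 T)), f s = g s) :
    ∫ s in (0 : ℝ)..t, f s = ∫ s in (0 : ℝ)..t, g s := by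
  refine intervalIntegral.integral_congr_ae ?_
  rw [ae_restrict_iff' measurableSet_Icc] at h
  filter_upwards [h] with s hs hst
  rw [Set.uIoc_of_le ht.1] at hst
  exact hs ⟨hst.1.le, hst.2.trans ht.2⟩

theorem norm_sq_integral_control_smul_le (u : Control T) {g : ℝ → V}
    (hg : ContinuousOn g (Set.Icc 0 T)) (ht : t ∈ Set.Icc 0 T) :
    ‖∫ s in (0 : ℝ)..t, u s • g s‖ ^ 2 ≤ ‖u‖ ^ 2 * ∫ s in (0 : ℝ)..t, ‖g s‖ ^ 2 := by
  have hsub : Set.Ioc 0 t ⊆ Set.Icc 0 T := fun s hs => ⟨hs.1.le, hs.2.trans ht.2⟩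
  have hle : volume.restrict (Set.Ioc 0 t) ≤ volume.restrict (Set.Icc 0 T) :=
    Measure.restrict_mono hsub le_rfl
  have hg2 : MemLp g 2 (volume.restrict (Set.Icc 0 T)) :=
    (memLp_two_iff_integrable_sq_norm (hg.aestronglyMeasurable measurableSet_Icc)).2
      ((hg.norm.pow 2).integrableOn_compact isCompact_Icc)
  rw [intervalIntegral.integral_of_le ht.1, intervalIntegral.integral_of_le ht.1]
  calc ‖∫ s in Set.Ioc 0 t, u s • g s‖ ^ 2 ≤ (∫ s in Set.Ioc 0 t, |u s| * ‖g s‖) ^ 2 := by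
        refine pow_le_pow_left₀ (norm_nonneg _) ((norm_integral_le_integral_norm _).trans_eq ?_) 2
        simp [norm_smul]
    _ ≤ (∫ s in Set.Ioc 0 t, u s ^ 2) * ∫ s in Set.Ioc 0 t, ‖g s‖ ^ 2 :=
        sq_integral_mul_norm_le ((Lp.memLp u).mono_measure hle) (hg2.mono_measure hle)
    _ ≤ ‖u‖ ^ 2 * ∫ s in Set.Ioc 0 t, ‖g s‖ ^ 2 := by
        rw [norm_sq_eq_integral_sq]
        exact mul_le_mul_of_nonneg_right (setIntegral_mono_set (Lp.memLp u).integrable_sq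
          (.of_forall fun s => sq_nonneg _) hsub.eventuallyLE)
          (integral_nonneg fun s => by positivity)

/-- The function `t ↦ ∫₀ᵗ u(s) f(s) ds` on `[0, T]`. -/
noncomputable def controlPrimitive (hT : 0 ≤ T) (u : Control T) (f : C(Set.Icc (0 : ℝ) T, V)) :
    C(Set.Icc (0 : ℝ) T, V) where
  toFun t := ∫ s in (0 : ℝ)..t, u s • Set.IccExtend hT f s
  continuous_toFun := by
    have h := intervalIntegral.continuousOn_primitive_interval (a := 0) (b := T)
      (μ := volume) (f := fun s => u s • Set.IccExtend hT f s) (by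
        rw [Set.uIcc_of_le hT]
        exact integrableOn_control_smul u f.continuous.Icc_extend'.continuousOn)
    rw [Set.uIcc_of_le hT] at h
    exact continuousOn_iff_continuous_domRestrict.1 h

variable (hT : 0 ≤ T) (u : Control T) (f : C(Set.Icc (0 : ℝ) T, V))

theorem controlPrimitive_apply (t : Set.Icc (0 : ℝ) T) :
    controlPrimitive hT u f t = ∫ s in (0 : ℝ)..t, u s • Set.IccExtend hT f s := rfl

theorem intervalIntegrable_control_smul_IccExtend (t : Set.Icc (0 : ℝ) T) :
    IntervalIntegrable (fun s => u s • Set.IccExtend hT f s) volume 0 t :=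
  intervalIntegrable_control_smul u f.continuous.Icc_extend'.continuousOn t.2

theorem controlPrimitive_add_left (v : Control T) :
    controlPrimitive hT (u + v) f = controlPrimitive hT u f + controlPrimitive hT v f := by
  ext t
  simp only [ContinuousMap.add_apply, controlPrimitive_apply]
  rw [← intervalIntegral.integral_add (intervalIntegrable_control_smul_IccExtend hT u f t)
    (intervalIntegrable_control_smul_IccExtend hT v f t)]
  refine intervalIntegral_congr_of_ae_restrict_Icc t.2 ?_
  filter_upwards [Lp.coeFn_add u v] with s hs
  rw [hs, Pi.add_apply, add_smul]

theorem controlPrimitive_smul_left (c : ℝ) :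
    controlPrimitive hT (c • u) f = c • controlPrimitive hT u f := by
  ext t
  simp only [ContinuousMap.smul_apply, controlPrimitive_apply]
  rw [← intervalIntegral.integral_smul]
  refine intervalIntegral_congr_of_ae_restrict_Icc t.2 ?_
  filter_upwards [Lp.coeFn_smul c u] with s hs
  rw [hs, Pi.smul_apply, smul_assoc]

theorem controlPrimitive_add_right (g : C(Set.Icc (0 : ℝ) T, V)) :
    controlPrimitive hT u (f + g) = controlPrimitive hT u f + controlPrimitive hT u g := by
  ext t
  simp only [ContinuousMap.add_apply, controlPrimitive_apply]
  rw [← intervalIntegral.integral_add (intervalIntegrable_control_smul_IccExtend hT u f t)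
    (intervalIntegrable_control_smul_IccExtend hT u g t)]
  simp [Set.IccExtend]

theorem controlPrimitive_smul_right (c : ℝ) :
    controlPrimitive hT u (c • f) = c • controlPrimitive hT u f := by
  ext t
  simp only [ContinuousMap.smul_apply, controlPrimitive_apply]
  rw [← intervalIntegral.integral_smul]
  simp [Set.IccExtend, smul_comm c]

theorem norm_sq_controlPrimitive_apply_le (t : Set.Icc (0 : ℝ) T) :
    ‖controlPrimitive hT u f t‖ ^ 2 ≤ ‖u‖ ^ 2 * ∫ s in (0 : ℝ)..t, ‖Set.IccExtend hT f s‖ ^ 2 :=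
  norm_sq_integral_control_smul_le u f.continuous.Icc_extend'.continuousOn t.2

theorem norm_controlPrimitive_le : ‖controlPrimitive hT u f‖ ≤ √T * ‖u‖ * ‖f‖ := by
  refine (ContinuousMap.norm_le _ (by positivity)).2 fun t => ?_
  refine le_of_sq_le_sq ?_ (by positivity)
  have hint : ∫ s in (0 : ℝ)..t, ‖Set.IccExtend hT f s‖ ^ 2 ≤ ∫ s in (0 : ℝ)..t, ‖f‖ ^ 2 :=
    intervalIntegral.integral_mono_on t.2.1 (Continuous.intervalIntegrable (by fun_prop) _ _)
      (Continuous.intervalIntegrable (by fun_prop) _ _)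
      fun s _ => pow_le_pow_left₀ (norm_nonneg _) (f.norm_coe_le_norm _) 2
  rw [intervalIntegral.integral_const, sub_zero, smul_eq_mul] at hint
  calc ‖controlPrimitive hT u f t‖ ^ 2
      ≤ ‖u‖ ^ 2 * (t * ‖f‖ ^ 2) := (norm_sq_controlPrimitive_apply_le hT u f t).trans
        (mul_le_mul_of_nonneg_left hint (by positivity))
    _ ≤ ‖u‖ ^ 2 * (T * ‖f‖ ^ 2) := by gcongr; exact t.2.2
    _ = (√T * ‖u‖ * ‖f‖) ^ 2 := by rw [mul_pow, mul_pow, Real.sq_sqrt hT]; ring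

/-- `controlPrimitive` as a continuous bilinear map in the control and the function. -/
noncomputable def controlPrimitiveL (V : Type*) [NormedAddCommGroup V] [NormedSpace ℝ V]
    (hT : 0 ≤ T) :
    Control T →L[ℝ] C(Set.Icc (0 : ℝ) T, V) →L[ℝ] C(Set.Icc (0 : ℝ) T, V) :=
  LinearMap.mkContinuous₂
    (LinearMap.mk₂ ℝ (controlPrimitive hT) (fun u v f => controlPrimitive_add_left hT u f v)
      (fun c u f => controlPrimitive_smul_left hT u f c) (controlPrimitive_add_right hT)
      (fun c u f => controlPrimitive_smul_right hT u f c))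
    √T (norm_controlPrimitive_le hT)

end ControlPrimitive

section Volterra

variable {T C : ℝ} {V : Type*} [NormedAddCommGroup V] [NormedSpace ℝ V] {hT : 0 ≤ T}
  {L L' : C(Set.Icc (0 : ℝ) T, V) →L[ℝ] C(Set.Icc (0 : ℝ) T, V)}

/-- The operator `L` on `C([0, T], V)` is of Volterra type with constant `C`: the value of `L f` at
`t` is controlled by the `L²` norm of `f` on `[0, t]`. -/
def HasVolterraBound (hT : 0 ≤ T) (L : C(Set.Icc (0 : ℝ) T, V) →L[ℝ] C(Set.Icc (0 : ℝ) T, V))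
    (C : ℝ) : Prop :=
  ∀ f (t : Set.Icc (0 : ℝ) T), ‖L f t‖ ^ 2 ≤ C * ∫ s in (0 : ℝ)..t, ‖Set.IccExtend hT f s‖ ^ 2

namespace HasVolterraBound

theorem controlPrimitiveL (hT : 0 ≤ T) (u : Control T) :
    HasVolterraBound hT (controlPrimitiveL V hT u) (‖u‖ ^ 2) :=
  norm_sq_controlPrimitive_apply_le hT u

theorem add {C' : ℝ} (hL : HasVolterraBound hT L C) (hL' : HasVolterraBound hT L' C') :
    HasVolterraBound hT (L + L') (2 * (C + C')) := fun f t =>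
  calc ‖L f t + L' f t‖ ^ 2 ≤ (‖L f t‖ + ‖L' f t‖) ^ 2 :=
        pow_le_pow_left₀ (norm_nonneg _) (norm_add_le _ _) 2
    _ ≤ 2 * (‖L f t‖ ^ 2 + ‖L' f t‖ ^ 2) := add_sq_le
    _ ≤ _ := by linarith [hL f t, hL' f t]

theorem comp_compLeftContinuous (hC : 0 ≤ C) (hL : HasVolterraBound hT L C) (A : V →L[ℝ] V) :
    HasVolterraBound hT (L.comp (A.compLeftContinuous ℝ _)) (C * ‖A‖ ^ 2) := fun f t => by
  have hmono : ∫ s in (0 : ℝ)..t, ‖Set.IccExtend hT (A.compLeftContinuous ℝ _ f) s‖ ^ 2 ≤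
      ∫ s in (0 : ℝ)..t, ‖A‖ ^ 2 * ‖Set.IccExtend hT f s‖ ^ 2 := by
    refine intervalIntegral.integral_mono_on t.2.1 (Continuous.intervalIntegrable (by fun_prop) _ _)
      (Continuous.intervalIntegrable (by fun_prop) _ _) fun s _ => ?_
    rw [← mul_pow]
    exact pow_le_pow_left₀ (norm_nonneg _) (A.le_opNorm _) 2
  rw [intervalIntegral.integral_const_mul] at hmono
  rw [mul_assoc]
  exact (hL _ t).trans (mul_le_mul_of_nonneg_left hmono hC)

theorem norm_sq_pow_apply_le (hC : 0 ≤ C) (hL : HasVolterraBound hT L C) (k : ℕ)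
    (f : C(Set.Icc (0 : ℝ) T, V)) (t : Set.Icc (0 : ℝ) T) :
    ‖(L ^ k) f t‖ ^ 2 ≤ (C * t) ^ k / k.factorial * ‖f‖ ^ 2 := by
  induction k generalizing t with
  | zero => simpa using pow_le_pow_left₀ (norm_nonneg _) (f.norm_coe_le_norm t) 2
  | succ k ih =>
    calc ‖(L ^ (k + 1)) f t‖ ^ 2
        ≤ C * ∫ s in (0 : ℝ)..t, ‖Set.IccExtend hT ((L ^ k) f) s‖ ^ 2 := by
          rw [pow_succ' L, mul_apply_eq_comp]
          exact hL _ t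
      _ ≤ C * ∫ s in (0 : ℝ)..t, (C * s) ^ k / k.factorial * ‖f‖ ^ 2 := by
          refine mul_le_mul_of_nonneg_left (intervalIntegral.integral_mono_on t.2.1
            (Continuous.intervalIntegrable (by fun_prop) _ _)
            (Continuous.intervalIntegrable (by fun_prop) _ _) fun s hs => ?_) hC
          rw [Set.IccExtend_of_mem _ _ ⟨hs.1, hs.2.trans t.2.2⟩]
          exact ih ⟨s, hs.1, hs.2.trans t.2.2⟩
      _ = C * ∫ s in (0 : ℝ)..t, (C ^ k / k.factorial * ‖f‖ ^ 2) * s ^ k := by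
          simp only [mul_pow, div_mul_eq_mul_div, mul_right_comm]
      _ = (C * t) ^ (k + 1) / (k + 1).factorial * ‖f‖ ^ 2 := by
          rw [intervalIntegral.integral_const_mul, integral_pow, Nat.factorial_succ]
          push_cast
          field_simp
          ring

theorem exists_norm_pow_lt_one (hC : 0 ≤ C) (hL : HasVolterraBound hT L C) :
    ∃ k : ℕ, ‖L ^ k‖ < 1 := by
  obtain ⟨k, hk⟩ : ∃ k : ℕ, (C * T) ^ k / k.factorial < 1 / 4 :=
    ((FloorSemiring.tendsto_pow_div_factorial_atTop (C * T)).eventually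
      (gt_mem_nhds (by norm_num))).exists
  refine ⟨k, lt_of_le_of_lt (ContinuousLinearMap.opNorm_le_bound _ (M := 1 / 2) (by norm_num)
    fun f => (ContinuousMap.norm_le _ (by positivity)).2 fun t =>
      le_of_sq_le_sq ?_ (by positivity)) (by norm_num)⟩
  calc ‖(L ^ k) f t‖ ^ 2 ≤ (C * t) ^ k / k.factorial * ‖f‖ ^ 2 := hL.norm_sq_pow_apply_le hC k f t
    _ ≤ (C * T) ^ k / k.factorial * ‖f‖ ^ 2 := by
        have := t.2.1
        have := t.2.2
        gcongr
    _ ≤ 1 / 4 * ‖f‖ ^ 2 := mul_le_mul_of_nonneg_right hk.le (by positivity)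
    _ = (1 / 2 * ‖f‖) ^ 2 := by ring

theorem isUnit_one_sub [CompleteSpace V] (hC : 0 ≤ C) (hL : HasVolterraBound hT L C) :
    IsUnit (1 - L) := by
  obtain ⟨k, hk⟩ := hL.exists_norm_pow_lt_one hC
  have h : IsUnit (1 - L ^ k) := isUnit_one_sub_of_norm_lt_one
    (R := C(Set.Icc (0 : ℝ) T, V) →L[ℝ] C(Set.Icc (0 : ℝ) T, V)) hk
  rw [← mul_neg_geom_sum L k] at h
  refine ((Commute.isUnit_mul_iff ?_).1 h).1
  exact (Commute.sub_left (Commute.one_left _)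
    (Commute.sum_right _ _ _ fun i _ => (Commute.refl L).pow_right i))

end HasVolterraBound

end Volterra

section Flow

variable {T : ℝ} {V : Type*} [NormedAddCommGroup V] [NormedSpace ℝ V]

/-- The integral operator `f ↦ ∫₀ᵗ (A₀ f + u A₁ f) ds` of the linear control system
`x' = (A₀ + u A₁) x`; the drift term is the one driven by the constant control `1`. -/
noncomputable def systemOperator (hT : 0 ≤ T) (A₀ A₁ : V →L[ℝ] V) (u : Control T) :
    C(Set.Icc (0 : ℝ) T, V) →L[ℝ] C(Set.Icc (0 : ℝ) T, V) :=
  (controlPrimitiveL V hT (Lp.const 2 (volume.restrict (Set.Icc (0 : ℝ) T)) (1 : ℝ))).comp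
      (A₀.compLeftContinuous ℝ _) +
    (controlPrimitiveL V hT u).comp (A₁.compLeftContinuous ℝ _)

variable (hT : 0 ≤ T) (A₀ A₁ : V →L[ℝ] V) (v : V) (u : Control T)

theorem systemOperator_apply (f : C(Set.Icc (0 : ℝ) T, V)) (t : Set.Icc (0 : ℝ) T) :
    systemOperator hT A₀ A₁ u f t
      = ∫ s in (0 : ℝ)..t, (A₀ (Set.IccExtend hT f s) + u s • A₁ (Set.IccExtend hT f s)) := by
  have hc : ∀ A : V →L[ℝ] V, ContinuousOn (fun s => A (Set.IccExtend hT f s)) (Set.Icc 0 T) :=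
    fun A => (A.continuous.comp f.continuous.Icc_extend').continuousOn
  change (∫ s in (0 : ℝ)..t, Lp.const 2 (volume.restrict (Set.Icc (0 : ℝ) T)) (1 : ℝ) s •
    A₀ (Set.IccExtend hT f s)) + (∫ s in (0 : ℝ)..t, u s • A₁ (Set.IccExtend hT f s)) = _
  rw [← intervalIntegral.integral_add (intervalIntegrable_control_smul _ (hc A₀) t.2)
    (intervalIntegrable_control_smul u (hc A₁) t.2)]
  refine intervalIntegral_congr_of_ae_restrict_Icc t.2 ?_
  filter_upwards [Lp.coeFn_const (p := 2) (μ := volume.restrict (Set.Icc (0 : ℝ) T)) (1 : ℝ)]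
    with s hs
  rw [hs, Function.const_apply, one_smul]

theorem contDiff_systemOperator : ContDiff ℝ ∞ (systemOperator hT A₀ A₁) :=
  contDiff_const.add ((controlPrimitiveL V hT).contDiff.clm_comp contDiff_const)

variable {A₀ A₁ u} in
theorem integral_system_congr {x y : ℝ → V} (h : Set.EqOn x y (Set.Icc 0 T))
    {t : ℝ} (ht : t ∈ Set.Icc 0 T) :
    ∫ s in (0 : ℝ)..t, (A₀ (x s) + u s • A₁ (x s)) =
      ∫ s in (0 : ℝ)..t, (A₀ (y s) + u s • A₁ (y s)) := by
  refine intervalIntegral.integral_congr fun s hs => ?_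
  rw [Set.uIcc_of_le ht.1] at hs
  simp only [h ⟨hs.1, hs.2.trans ht.2⟩]

/-- The solution on `[0, T]` of `x' = (A₀ + u A₁) x`, `x(0) = v`. -/
noncomputable def flow (hT : 0 ≤ T) (A₀ A₁ : V →L[ℝ] V) (v : V) (u : Control T) :
    C(Set.Icc (0 : ℝ) T, V) :=
  Ring.inverse (1 - systemOperator hT A₀ A₁ u) (ContinuousMap.const _ v)

variable [CompleteSpace V]

theorem isUnit_one_sub_systemOperator : IsUnit (1 - systemOperator hT A₀ A₁ u) :=
  HasVolterraBound.isUnit_one_sub (by positivity)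
    (((HasVolterraBound.controlPrimitiveL hT _).comp_compLeftContinuous (by positivity) A₀).add
      ((HasVolterraBound.controlPrimitiveL hT u).comp_compLeftContinuous (by positivity) A₁))

theorem contDiff_flow : ContDiff ℝ ∞ (flow hT A₀ A₁ v) := by
  refine ContDiff.clm_apply (contDiff_iff_contDiffAt.2 fun u => ?_) contDiff_const
  obtain ⟨U, hU⟩ := isUnit_one_sub_systemOperator hT A₀ A₁ u
  have h := contDiffAt_ringInverse (R := C(Set.Icc (0 : ℝ) T, V) →L[ℝ] C(Set.Icc (0 : ℝ) T, V)) ℝ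
    (n := ∞) U
  rw [hU] at h
  exact h.comp u (contDiff_const.sub (contDiff_systemOperator hT A₀ A₁)).contDiffAt

variable {A₀ A₁ v u}

theorem eq_flow_iff_sub_systemOperator {f : C(Set.Icc (0 : ℝ) T, V)} :
    f = flow hT A₀ A₁ v u ↔ f - systemOperator hT A₀ A₁ u f = ContinuousMap.const _ v := by
  have hu := isUnit_one_sub_systemOperator hT A₀ A₁ u
  constructor
  · rintro rfl
    exact DFunLike.congr_fun (Ring.mul_inverse_cancel _ hu) (ContinuousMap.const _ v)
  · intro h
    rw [flow, ← h]
    exact (DFunLike.congr_fun (Ring.inverse_mul_cancel _ hu) f).symm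

theorem eq_flow_iff {f : C(Set.Icc (0 : ℝ) T, V)} :
    f = flow hT A₀ A₁ v u ↔ ∀ t : Set.Icc (0 : ℝ) T, f t = v +
      ∫ s in (0 : ℝ)..t, (A₀ (Set.IccExtend hT f s) + u s • A₁ (Set.IccExtend hT f s)) := by
  rw [eq_flow_iff_sub_systemOperator, ContinuousMap.ext_iff]
  simp only [← systemOperator_apply, ContinuousMap.sub_apply, ContinuousMap.const_apply,
    sub_eq_iff_eq_add]

theorem caratheodory_iff {x : ℝ → V} :
    (ContinuousOn x (Set.Icc 0 T) ∧ ∀ t ∈ Set.Icc (0 : ℝ) T,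
      x t = v + ∫ s in (0 : ℝ)..t, (A₀ (x s) + u s • A₁ (x s))) ↔
    ∀ t : Set.Icc (0 : ℝ) T, x t = flow hT A₀ A₁ v u t := by
  have hext : ∀ f : C(Set.Icc (0 : ℝ) T, V), (∀ t : Set.Icc (0 : ℝ) T, x t = f t) →
      Set.EqOn x (Set.IccExtend hT f) (Set.Icc 0 T) := fun f hf t ht =>
    (hf ⟨t, ht⟩).trans (Set.IccExtend_of_mem hT f ht).symm
  constructor
  · rintro ⟨hx, h⟩
    let f : C(Set.Icc (0 : ℝ) T, V) := ⟨_, continuousOn_iff_continuous_domRestrict.1 hx⟩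
    have hf : f = flow hT A₀ A₁ v u := (eq_flow_iff hT).2 fun t =>
      (h t t.2).trans (by rw [integral_system_congr (hext f fun _ => rfl) t.2])
    exact fun t => DFunLike.congr_fun hf t
  · intro h
    refine ⟨(flow hT A₀ A₁ v u).continuous.Icc_extend'.continuousOn.congr (hext _ h),
      fun t ht => ?_⟩
    rw [integral_system_congr (hext _ h) ht]
    exact (h ⟨t, ht⟩).trans ((eq_flow_iff hT).1 rfl ⟨t, ht⟩)

end Flow

section ContinuousControl

variable {T : ℝ} {V : Type*} [NormedAddCommGroup V] [NormedSpace ℝ V]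

theorem dense_continuous_control (T : ℝ) :
    Dense {u : Control T | ∃ c : ℝ → ℝ, Continuous c ∧ u =ᵐ[volume.restrict (Set.Icc 0 T)] c} := by
  refine (BoundedContinuousFunction.toLp_denseRange ℝ
    (volume.restrict (Set.Icc (0 : ℝ) T)) ℝ (p := 2) (by norm_num)).mono ?_
  rintro _ ⟨c, rfl⟩
  exact ⟨c, c.continuous, BoundedContinuousFunction.coeFn_toLp (p := 2) (𝕜 := ℝ) _ c⟩

theorem integral_system_eq_of_ae_eq {A₀ A₁ : V →L[ℝ] V} {u : Control T} {c : ℝ → ℝ}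
    (hu : u =ᵐ[volume.restrict (Set.Icc 0 T)] c) (x : ℝ → V) {t : ℝ} (ht : t ∈ Set.Icc 0 T) :
    ∫ s in (0 : ℝ)..t, (A₀ (x s) + u s • A₁ (x s)) =
      ∫ s in (0 : ℝ)..t, (A₀ (x s) + c s • A₁ (x s)) := by
  refine intervalIntegral_congr_of_ae_restrict_Icc ht ?_
  filter_upwards [hu] with s hs
  rw [hs]

variable [CompleteSpace V] (hT : 0 ≤ T) {A₀ A₁ : V →L[ℝ] V} {v : V} {u : Control T} {c : ℝ → ℝ}

theorem exists_hasDerivAt_flow (hc : Continuous c) (hu : u =ᵐ[volume.restrict (Set.Icc 0 T)] c) :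
    ∃ x : ℝ → V, x 0 = v ∧ (∀ t ∈ Set.Icc 0 T, HasDerivAt x (A₀ (x t) + c t • A₁ (x t)) t) ∧
      ∀ t : Set.Icc (0 : ℝ) T, x t = flow hT A₀ A₁ v u t := by
  set g := Set.IccExtend hT (flow hT A₀ A₁ v u) with hg
  have hgc : Continuous g := (flow hT A₀ A₁ v u).continuous.Icc_extend'
  have hG : Continuous fun s => A₀ (g s) + c s • A₁ (g s) := by fun_prop
  let x : ℝ → V := fun t => v + ∫ s in (0 : ℝ)..t, (A₀ (g s) + c s • A₁ (g s))
  have hx : ∀ t : Set.Icc (0 : ℝ) T, x t = flow hT A₀ A₁ v u t := fun t => by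
    rw [(eq_flow_iff hT).1 rfl t, integral_system_eq_of_ae_eq hu _ t.2]
  refine ⟨x, by simp [x], fun t ht => ?_, hx⟩
  have hxg : x t = g t := by rw [hg, Set.IccExtend_of_mem _ _ ht]; exact hx ⟨t, ht⟩
  rw [hxg]
  exact (intervalIntegral.integral_hasDerivAt_right (hG.intervalIntegrable _ _)
    hG.aestronglyMeasurable.stronglyMeasurableAtFilter hG.continuousAt).const_add v

theorem eq_flow_of_hasDerivAt (hc : Continuous c) (hu : u =ᵐ[volume.restrict (Set.Icc 0 T)] c)
    {x : ℝ → V} (hx₀ : x 0 = v)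
    (hx : ∀ t ∈ Set.Icc 0 T, HasDerivAt x (A₀ (x t) + c t • A₁ (x t)) t)
    (t : Set.Icc (0 : ℝ) T) : x t = flow hT A₀ A₁ v u t := by
  have hxc : ContinuousOn x (Set.Icc 0 T) := fun t ht => (hx t ht).continuousAt.continuousWithinAt
  refine (caratheodory_iff hT).1 ⟨hxc, fun t ht => ?_⟩ t
  have hsub : Set.uIcc 0 t ⊆ Set.Icc 0 T := by
    rw [Set.uIcc_of_le ht.1]
    exact Set.Icc_subset_Icc_right ht.2
  have hcont : ContinuousOn (fun s => A₀ (x s) + c s • A₁ (x s)) (Set.uIcc 0 t) := by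
    have := hxc.mono hsub
    fun_prop
  rw [integral_system_eq_of_ae_eq hu x ht, intervalIntegral.integral_eq_sub_of_hasDerivAt
    (fun s hs => hx s (hsub hs)) hcont.intervalIntegrable, hx₀, add_sub_cancel]

end ContinuousControl

section Propagator

variable {𝔸 : Type*} [NormedRing 𝔸] [NormedAlgebra ℝ 𝔸]

/-- The commutator `b ↦ [a, b]` as a continuous linear map. -/
noncomputable def commutatorL (a : 𝔸) : 𝔸 →L[ℝ] 𝔸 :=
  ContinuousLinearMap.mul ℝ 𝔸 a - (ContinuousLinearMap.mul ℝ 𝔸).flip a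

theorem commutatorL_apply (a b : 𝔸) : commutatorL a b = a * b - b * a := rfl

/-- The fundamental solution on `[0, T]` of `X' = (a₀ + u a₁) X`, `X(0) = 1`. -/
noncomputable def propagator {T : ℝ} (hT : 0 ≤ T) (a₀ a₁ : 𝔸) (u : Control T) :
    C(Set.Icc (0 : ℝ) T, 𝔸) :=
  flow hT (ContinuousLinearMap.mul ℝ 𝔸 a₀) (ContinuousLinearMap.mul ℝ 𝔸 a₁) 1 u

theorem continuous_propagator_apply [CompleteSpace 𝔸] {T : ℝ} (hT : 0 ≤ T) (a₀ a₁ : 𝔸)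
    (t : Set.Icc (0 : ℝ) T) : Continuous fun u : Control T => propagator hT a₀ a₁ u t :=
  (continuous_eval_const t).comp (contDiff_flow hT _ _ _).continuous

variable [StarRing 𝔸] [ContinuousStar 𝔸] [StarModule ℝ 𝔸] {T t : ℝ} {a a₀ a₁ : 𝔸} {X : ℝ → 𝔸}

theorem hasDerivAt_star_of_mem_skewAdjoint (ha : a ∈ skewAdjoint 𝔸)
    (hX : HasDerivAt X (a * X t) t) :
    HasDerivAt (fun s => star (X s)) (-(star (X t) * a)) t :=
  hX.star.congr_deriv (by rw [star_mul, skewAdjoint.mem_iff.1 ha, mul_neg])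

theorem hasDerivAt_mul_mul_star (ha : a ∈ skewAdjoint 𝔸) (hX : HasDerivAt X (a * X t) t) (b : 𝔸) :
    HasDerivAt (fun s => X s * b * star (X s)) (commutatorL a (X t * b * star (X t))) t :=
  ((hX.mul_const b).mul (hasDerivAt_star_of_mem_skewAdjoint ha hX)).congr_deriv <| by
    rw [commutatorL_apply]
    noncomm_ring

theorem star_mul_self_eq_one_of_hasDerivAt {A : ℝ → 𝔸} (hA : ∀ t, A t ∈ skewAdjoint 𝔸)
    (hX₀ : X 0 = 1) (hX : ∀ t ∈ Set.Icc 0 T, HasDerivAt X (A t * X t) t) (ht : t ∈ Set.Icc 0 T) :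
    star (X t) * X t = 1 := by
  have hderiv : ∀ t ∈ Set.Icc 0 T, HasDerivAt (fun t => star (X t) * X t) 0 t := fun t ht =>
    ((hasDerivAt_star_of_mem_skewAdjoint (hA t) (hX t ht)).mul (hX t ht)).congr_deriv
      (by noncomm_ring)
  rw [constant_of_has_deriv_right_zero
    (fun t ht => (hderiv t ht).continuousAt.continuousWithinAt)
    (fun t ht => (hderiv t (Set.Ico_subset_Icc_self ht)).hasDerivWithinAt) t ht]
  simp [hX₀]

variable [CompleteSpace 𝔸] (hT : 0 ≤ T) (ha₀ : a₀ ∈ skewAdjoint 𝔸) (ha₁ : a₁ ∈ skewAdjoint 𝔸)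

include ha₀ ha₁

theorem propagator_of_continuous {u : Control T} {c : ℝ → ℝ} (hc : Continuous c)
    (hu : u =ᵐ[volume.restrict (Set.Icc 0 T)] c) (b : 𝔸) (t : Set.Icc (0 : ℝ) T) :
    star (propagator hT a₀ a₁ u t) * propagator hT a₀ a₁ u t = 1 ∧
      propagator hT a₀ a₁ u t * b * star (propagator hT a₀ a₁ u t) =
        flow hT (commutatorL a₀) (commutatorL a₁) b u t := by
  obtain ⟨X, hX₀, hX, hXt⟩ := exists_hasDerivAt_flow hT (A₀ := ContinuousLinearMap.mul ℝ 𝔸 a₀)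
    (A₁ := ContinuousLinearMap.mul ℝ 𝔸 a₁) (v := 1) hc hu
  have hskew : ∀ t, a₀ + c t • a₁ ∈ skewAdjoint 𝔸 := fun t =>
    add_mem ha₀ (skewAdjoint.smul_mem (c t) ha₁)
  have hX' : ∀ t ∈ Set.Icc 0 T, HasDerivAt X ((a₀ + c t • a₁) * X t) t := fun t ht =>
    (hX t ht).congr_deriv (by simp [add_mul])
  rw [propagator, ← hXt]
  refine ⟨star_mul_self_eq_one_of_hasDerivAt hskew hX₀ hX' t.2,
    eq_flow_of_hasDerivAt hT (x := fun t => X t * b * star (X t)) hc hu (by simp [hX₀])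
      (fun t ht => (hasDerivAt_mul_mul_star (hskew t) (hX' t ht) b).congr_deriv ?_) t⟩
  simp only [commutatorL_apply, add_mul, mul_add, smul_mul_assoc, mul_smul_comm, smul_sub]
  abel

theorem star_propagator_mul_self (u : Control T) (t : Set.Icc (0 : ℝ) T) :
    star (propagator hT a₀ a₁ u t) * propagator hT a₀ a₁ u t = 1 := by
  have hcont := continuous_propagator_apply hT a₀ a₁ t
  refine congrFun ((hcont.star.mul hcont).ext_on (dense_continuous_control T) continuous_const ?_) u
  rintro u ⟨c, hc, hu⟩
  exact (propagator_of_continuous hT ha₀ ha₁ hc hu 1 t).1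

theorem flow_commutatorL_eq (b : 𝔸) (u : Control T) (t : Set.Icc (0 : ℝ) T) :
    flow hT (commutatorL a₀) (commutatorL a₁) b u t =
      propagator hT a₀ a₁ u t * b * star (propagator hT a₀ a₁ u t) := by
  have hcont := continuous_propagator_apply hT a₀ a₁ t
  refine congrFun (((continuous_eval_const t).comp (contDiff_flow hT _ _ _).continuous).ext_on
    (dense_continuous_control T) ((hcont.mul continuous_const).mul hcont.star) ?_) u
  rintro u ⟨c, hc, hu⟩
  exact (propagator_of_continuous hT ha₀ ha₁ hc hu b t).2.symm

end Propagator

section UnitaryOrbit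

theorem exists_smul_mem_specialUnitaryGroup {ι : Type*} [Fintype ι] [DecidableEq ι]
    {U : Matrix ι ι ℂ} (hU : U ∈ Matrix.unitaryGroup ι ℂ) :
    ∃ z ∈ unitary ℂ, z • U ∈ Matrix.specialUnitaryGroup ι ℂ := by
  obtain ⟨z, hz, hdet⟩ : ∃ z ∈ unitary ℂ, z ^ Fintype.card ι * U.det = 1 := by
    rcases isEmpty_or_nonempty ι with hι | hι
    · exact ⟨1, one_mem _, by simp⟩
    have hU₁ : ‖U.det‖ = 1 := CStarRing.norm_of_mem_unitary (Matrix.det_of_mem_unitary hU)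
    obtain ⟨z, hz⟩ := IsAlgClosed.exists_pow_nat_eq U.det⁻¹ (Fintype.card_pos (α := ι))
    have hz₁ : ‖z‖ = 1 := by
      refine (pow_eq_one_iff_of_nonneg (norm_nonneg z) (Fintype.card_ne_zero (α := ι))).1 ?_
      rw [← norm_pow, hz, norm_inv, hU₁, inv_one]
    refine ⟨z, Unitary.mem_iff_star_mul_self.2 ?_, ?_⟩
    · simp [Complex.conj_mul', hz₁]
    · rw [hz, inv_mul_cancel₀ (norm_ne_zero_iff.1 (hU₁ ▸ one_ne_zero))]
  exact ⟨z, hz, Matrix.mem_specialUnitaryGroup_iff.2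
    ⟨Unitary.smul_mem_of_mem hz hU, by rw [Matrix.det_smul, hdet]⟩⟩

theorem charpoly_conjStarAlgAut {ι 𝕜 : Type*} [Fintype ι] [DecidableEq ι] [RCLike 𝕜]
    (U : Matrix.unitaryGroup ι 𝕜) (A : Matrix ι ι 𝕜) :
    (Unitary.conjStarAlgAut 𝕜 _ U A).charpoly = A.charpoly := by
  rw [Unitary.conjStarAlgAut_apply, Matrix.charpoly_mul_comm, ← mul_assoc,
    Unitary.coe_star_mul_self, one_mul]

theorem trace_conjStarAlgAut {ι 𝕜 : Type*} [Fintype ι] [DecidableEq ι] [RCLike 𝕜]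
    (U : Matrix.unitaryGroup ι 𝕜) (A : Matrix ι ι 𝕜) :
    (Unitary.conjStarAlgAut 𝕜 _ U A).trace = A.trace := by
  rw [Unitary.conjStarAlgAut_apply, Matrix.trace_mul_comm, ← mul_assoc,
    Unitary.coe_star_mul_self, one_mul]

variable {n : ℕ} {ρ A : Matrix (Fin n) (Fin n) ℂ}

theorem mem_unitaryOrbit_iff :
    A ∈ unitaryOrbit ρ ↔
      ∃ U : Matrix.unitaryGroup (Fin n) ℂ, A = Unitary.conjStarAlgAut ℂ _ U ρ := by
  constructor
  · rintro ⟨U, hU, rfl⟩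
    exact ⟨⟨U, hU.1⟩, rfl⟩
  · rintro ⟨U, rfl⟩
    obtain ⟨z, hz, hzU⟩ := exists_smul_mem_specialUnitaryGroup U.2
    refine ⟨z • (U : Matrix (Fin n) (Fin n) ℂ), hzU, ?_⟩
    rw [Unitary.conjStarAlgAut_apply, Matrix.conjTranspose_smul, Matrix.smul_mul,
      smul_mul_smul_comm, Unitary.mul_star_self_of_mem hz, one_smul]
    rfl

theorem conjStarAlgAut_mem_unitaryOrbit (U : Matrix.unitaryGroup (Fin n) ℂ)
    (hA : A ∈ unitaryOrbit ρ) : Unitary.conjStarAlgAut ℂ _ U A ∈ unitaryOrbit ρ := by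
  obtain ⟨V, rfl⟩ := mem_unitaryOrbit_iff.1 hA
  exact mem_unitaryOrbit_iff.2 ⟨U * V, (Unitary.conjStarAlgAut_mul_apply U V ρ).symm⟩

theorem image_conjStarAlgAut_unitaryOrbit (U : Matrix.unitaryGroup (Fin n) ℂ) :
    Unitary.conjStarAlgAut ℂ _ U '' unitaryOrbit ρ = unitaryOrbit ρ := by
  refine Set.Subset.antisymm (Set.image_subset_iff.2 fun A => conjStarAlgAut_mem_unitaryOrbit U)
    fun A hA => ⟨_, conjStarAlgAut_mem_unitaryOrbit U⁻¹ hA, ?_⟩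
  rw [← Unitary.conjStarAlgAut_mul_apply, mul_inv_cancel, map_one, StarAlgEquiv.one_apply]

theorem charpoly_eq_of_mem_unitaryOrbit (hA : A ∈ unitaryOrbit ρ) : A.charpoly = ρ.charpoly := by
  obtain ⟨U, rfl⟩ := mem_unitaryOrbit_iff.1 hA
  exact charpoly_conjStarAlgAut U ρ

theorem isHermitian_of_mem_unitaryOrbit (hρ : ρ.IsHermitian) (hA : A ∈ unitaryOrbit ρ) :
    A.IsHermitian := by
  obtain ⟨U, -, rfl⟩ := hA
  exact Matrix.isHermitian_mul_mul_conjTranspose U hρ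

theorem mem_unitaryOrbit_of_charpoly_eq (hA : A.IsHermitian) (hρ : ρ.IsHermitian)
    (h : A.charpoly = ρ.charpoly) : A ∈ unitaryOrbit ρ := by
  refine mem_unitaryOrbit_iff.2 ⟨hA.eigenvectorUnitary * hρ.eigenvectorUnitary⁻¹, ?_⟩
  rw [Unitary.conjStarAlgAut_mul_apply, map_inv]
  exact hA.spectral_theorem.trans <| congrArg _ <| by
    rw [(hA.eigenvalues_eq_eigenvalues_iff hρ).2 h]
    exact (StarAlgEquiv.symm_apply_eq _).2 hρ.spectral_theorem |>.symm

end UnitaryOrbit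

section EndPoint

variable {n : ℕ} {T : ℝ} (hT : 0 ≤ T) {H₀ H₁ ρ₀ : Matrix (Fin n) (Fin n) ℂ}

include hT

theorem isTrajectory_iff {u : Control T} {ρ : ℝ → Matrix (Fin n) (Fin n) ℂ} :
    IsTrajectory H₀ H₁ ρ₀ T u ρ ↔
      ∀ t : Set.Icc (0 : ℝ) T, ρ t = flow hT (commutatorL H₀) (commutatorL H₁) ρ₀ u t := by
  have hcomm : ∀ s, commutatorL H₀ (ρ s) + u s • commutatorL H₁ (ρ s)
      = (H₀ + u s • H₁) * ρ s - ρ s * (H₀ + u s • H₁) := fun s => by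
    rw [commutatorL_apply, commutatorL_apply, add_mul, mul_add, smul_mul_assoc, mul_smul_comm,
      smul_sub]
    abel
  simp only [← caratheodory_iff, IsTrajectory, hcomm]

theorem exists_isTrajectory (u : Control T) : ∃ ρ, IsTrajectory H₀ H₁ ρ₀ T u ρ :=
  ⟨Set.IccExtend hT (flow hT (commutatorL H₀) (commutatorL H₁) ρ₀ u),
    (isTrajectory_iff hT).2 fun t => Set.IccExtend_of_mem _ _ t.2⟩

theorem endPoint_eq_flow (u : Control T) :
    endPoint H₀ H₁ ρ₀ T u
      = flow hT (commutatorL H₀) (commutatorL H₁) ρ₀ u ⟨T, Set.right_mem_Icc.2 hT⟩ := by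
  have h := exists_isTrajectory (H₀ := H₀) (H₁ := H₁) (ρ₀ := ρ₀) hT u
  rw [endPoint, dif_pos h]
  exact (isTrajectory_iff hT).1 h.choose_spec ⟨T, Set.right_mem_Icc.2 hT⟩

theorem isTrajectory_apply_eq_endPoint {u : Control T} {ρ : ℝ → Matrix (Fin n) (Fin n) ℂ}
    (h : IsTrajectory H₀ H₁ ρ₀ T u ρ) : ρ T = endPoint H₀ H₁ ρ₀ T u := by
  rw [endPoint_eq_flow hT]
  exact (isTrajectory_iff hT).1 h ⟨T, Set.right_mem_Icc.2 hT⟩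

variable (H₀ H₁ ρ₀) in
theorem contDiff_endPoint : ContDiff ℝ ∞ (endPoint H₀ H₁ ρ₀ T) := by
  rw [funext (endPoint_eq_flow hT)]
  exact (ContinuousMap.evalCLM ℝ (⟨T, Set.right_mem_Icc.2 hT⟩ : Set.Icc (0 : ℝ) T)).contDiff.comp
    (contDiff_flow hT (commutatorL H₀) (commutatorL H₁) ρ₀)

variable (ρ₀) in
theorem endPoint_mem_unitaryOrbit (hH₀ : H₀ᴴ = -H₀) (hH₁ : H₁ᴴ = -H₁) (u : Control T) :
    endPoint H₀ H₁ ρ₀ T u ∈ unitaryOrbit ρ₀ := by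
  have hH₀' : H₀ ∈ skewAdjoint (Matrix (Fin n) (Fin n) ℂ) := hH₀
  have hH₁' : H₁ ∈ skewAdjoint (Matrix (Fin n) (Fin n) ℂ) := hH₁
  rw [endPoint_eq_flow hT, flow_commutatorL_eq hT hH₀' hH₁']
  exact mem_unitaryOrbit_iff.2
    ⟨⟨_, Matrix.mem_unitaryGroup_iff'.2 (star_propagator_mul_self hT hH₀' hH₁' u _)⟩, rfl⟩

end EndPoint

section TangentVectors

variable {E F : Type*} [NormedAddCommGroup E] [NormedSpace ℝ E]
  [NormedAddCommGroup F] [NormedSpace ℝ F]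

theorem fderiv_mem_tangentVectors {f : E → F} (hf : ContDiff ℝ ∞ f) {S : Set E} {S' : Set F}
    (hS : Set.MapsTo f S S') {x v : E} (hv : v ∈ tangentVectors S x) :
    fderiv ℝ f x v ∈ tangentVectors S' (f x) := by
  obtain ⟨ε, hε, γ, hγ, hγS, rfl, hγv⟩ := hv
  exact ⟨ε, hε, f ∘ γ, hf.comp_contDiffOn hγ, fun t ht => hS (hγS t ht), rfl,
    (hf.differentiable (by simp) _).hasFDerivAt.comp_hasDerivAt 0 hγv⟩

theorem mem_tangentVectors_univ (x v : E) : v ∈ tangentVectors Set.univ x := by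
  refine ⟨1, one_pos, fun t => x + t • v, by fun_prop, fun _ _ => trivial, by simp, ?_⟩
  simpa using ((hasDerivAt_id (0 : ℝ)).smul_const v).const_add x

theorem range_fderiv_le_span_tangentVectors {f : E → F} (hf : ContDiff ℝ ∞ f) {S : Set F}
    (hS : ∀ x, f x ∈ S) (x : E) :
    (fderiv ℝ f x).range ≤ Submodule.span ℝ (tangentVectors S (f x)) := by
  rintro _ ⟨v, rfl⟩
  exact Submodule.subset_span
    (fderiv_mem_tangentVectors hf (fun y _ => hS y) (mem_tangentVectors_univ x v))

theorem tangentVectors_image (e : E ≃L[ℝ] F) (S : Set E) (x : E) :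
    tangentVectors (e '' S) (e x) = e '' tangentVectors S x := by
  refine Set.Subset.antisymm (fun w hw => ⟨e.symm w, ?_, e.apply_symm_apply w⟩) ?_
  · simpa [e.symm.fderiv] using fderiv_mem_tangentVectors e.symm.contDiff (S' := S)
      (by rintro _ ⟨y, hy, rfl⟩; simpa using hy) hw
  · rintro _ ⟨v, hv, rfl⟩
    simpa [e.fderiv] using fderiv_mem_tangentVectors e.contDiff (Set.mapsTo_image e S) hv

theorem finrank_span_tangentVectors_image (e : E ≃L[ℝ] F) (S : Set E) (x : E) :
    Module.finrank ℝ (Submodule.span ℝ (tangentVectors (e '' S) (e x))) =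
      Module.finrank ℝ (Submodule.span ℝ (tangentVectors S x)) := by
  rw [tangentVectors_image, ← LinearEquiv.finrank_map_eq e.toLinearEquiv, Submodule.map_span]
  rfl

variable {f : E → F} {J : F → ℝ} {S : Set F} {x : E}

theorem mem_criticalPoints_comp (hf : ContDiff ℝ ∞ f) (hS : ∀ x, f x ∈ S)
    (hx : f x ∈ criticalPointsOn J S) : x ∈ criticalPoints (J ∘ f) := by
  have hJf := hx.2.1.hasFDerivAt.comp x (hf.differentiable (by simp) x).hasFDerivAt
  exact hJf.congr_fderiv <| ContinuousLinearMap.ext fun v =>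
    hx.2.2 _ (fderiv_mem_tangentVectors hf (fun y _ => hS y) (mem_tangentVectors_univ x v))

theorem mem_criticalPointsOn_of_mem_criticalPoints_comp (hf : ContDiff ℝ ∞ f) (hxS : f x ∈ S)
    (hJ : DifferentiableAt ℝ J (f x))
    (hrange : tangentVectors S (f x) ⊆ (fderiv ℝ f x).range)
    (hx : x ∈ criticalPoints (J ∘ f)) : f x ∈ criticalPointsOn J S := by
  refine ⟨hxS, hJ, fun v hv => ?_⟩
  obtain ⟨w, rfl⟩ := hrange hv
  have hJf := hJ.hasFDerivAt.comp x (hf.differentiable (by simp) x).hasFDerivAt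
  exact congrArg (fun L : E →L[ℝ] ℝ => L w) (hJf.unique hx)

end TangentVectors

section EndPointRank

variable {n : ℕ} {T : ℝ} {H₀ H₁ ρ₀ ρ : Matrix (Fin n) (Fin n) ℂ} {u : Control T}

theorem finrank_span_tangentVectors_unitaryOrbit (hρ : ρ ∈ unitaryOrbit ρ₀) :
    Module.finrank ℝ (Submodule.span ℝ (tangentVectors (unitaryOrbit ρ₀) ρ)) = orbitDim ρ₀ := by
  obtain ⟨U, rfl⟩ := mem_unitaryOrbit_iff.1 hρ
  let e := (Unitary.conjStarAlgAut ℝ (Matrix (Fin n) (Fin n) ℂ)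
    U).toAlgEquiv.toLinearEquiv.toContinuousLinearEquiv
  have he : e '' unitaryOrbit ρ₀ = unitaryOrbit ρ₀ := image_conjStarAlgAut_unitaryOrbit U
  have h := finrank_span_tangentVectors_image e (unitaryOrbit ρ₀) ρ₀
  rwa [he] at h

variable (hT : 0 ≤ T) (hH₀ : H₀ᴴ = -H₀) (hH₁ : H₁ᴴ = -H₁)

include hT hH₀ hH₁

theorem finrank_range_fderiv_endPoint_le (u : Control T) :
    Module.finrank ℝ (fderiv ℝ (endPoint H₀ H₁ ρ₀ T) u).range ≤ orbitDim ρ₀ := by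
  have hS := endPoint_mem_unitaryOrbit hT ρ₀ hH₀ hH₁
  rw [← finrank_span_tangentVectors_unitaryOrbit (hS u)]
  exact Submodule.finrank_mono
    (range_fderiv_le_span_tangentVectors (contDiff_endPoint hT H₀ H₁ ρ₀) hS u)

theorem tangentVectors_unitaryOrbit_subset_range (hu : IsRegularControl H₀ H₁ ρ₀ T u) :
    tangentVectors (unitaryOrbit ρ₀) (endPoint H₀ H₁ ρ₀ T u) ⊆
      (fderiv ℝ (endPoint H₀ H₁ ρ₀ T) u).range := by
  have hS := endPoint_mem_unitaryOrbit hT ρ₀ hH₀ hH₁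
  rw [Submodule.eq_of_le_of_finrank_eq
    (range_fderiv_le_span_tangentVectors (contDiff_endPoint hT H₀ H₁ ρ₀) hS u)
    (hu.trans (finrank_span_tangentVectors_unitaryOrbit (hS u)).symm)]
  exact Submodule.subset_span

end EndPointRank

section Cost

variable {n : ℕ} {θ : Matrix (Fin n) (Fin n) ℂ}

/-- The cost `ρ ↦ Re tr(ρ θ)` as a continuous linear functional. -/
noncomputable def costL (θ : Matrix (Fin n) (Fin n) ℂ) : Matrix (Fin n) (Fin n) ℂ →L[ℝ] ℝ :=
  Complex.reCLM ∘L
    LinearMap.toContinuousLinearMap (Matrix.traceLinearMap (Fin n) ℝ ℂ) ∘L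
      (ContinuousLinearMap.mul ℝ _).flip θ

theorem cost_eq_costL (θ : Matrix (Fin n) (Fin n) ℂ) : cost θ = costL θ := rfl

theorem mem_criticalPointsOn_cost_iff {ρ : Matrix (Fin n) (Fin n) ℂ}
    {S : Set (Matrix (Fin n) (Fin n) ℂ)} :
    ρ ∈ criticalPointsOn (cost θ) S ↔ ρ ∈ S ∧ ∀ v ∈ tangentVectors S ρ, cost θ v = 0 := by
  rw [cost_eq_costL, criticalPointsOn, Set.mem_ofPred_eq, ContinuousLinearMap.fderiv]
  simp only [(costL θ).differentiableAt, true_and]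

theorem criticalPoints_controlCost {T : ℝ} (hT : 0 ≤ T) {H₀ H₁ ρ₀ : Matrix (Fin n) (Fin n) ℂ}
    (hH₀ : H₀ᴴ = -H₀) (hH₁ : H₁ᴴ = -H₁)
    (hreg : ∀ u ∈ criticalPoints (controlCost H₀ H₁ ρ₀ θ T), IsRegularControl H₀ H₁ ρ₀ T u) :
    criticalPoints (controlCost H₀ H₁ ρ₀ θ T)
      = endPoint H₀ H₁ ρ₀ T ⁻¹' criticalPointsOn (cost θ) (unitaryOrbit ρ₀) := by
  have hS := endPoint_mem_unitaryOrbit hT ρ₀ hH₀ hH₁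
  have hsmooth := contDiff_endPoint hT H₀ H₁ ρ₀
  refine Set.Subset.antisymm (fun u hu => ?_) fun u hu => mem_criticalPoints_comp hsmooth hS hu
  exact mem_criticalPointsOn_of_mem_criticalPoints_comp hsmooth (hS u) (costL θ).differentiableAt
    (tangentVectors_unitaryOrbit_subset_range hT hH₀ hH₁ (hreg u hu)) hu

end Cost

section CriticalPointsCommute

variable {n : ℕ} {ρ₀ ρ θ v X : Matrix (Fin n) (Fin n) ℂ}

theorem commutator_mem_tangentVectors (hρ : ρ ∈ unitaryOrbit ρ₀)
    (hX : X ∈ skewAdjoint (Matrix (Fin n) (Fin n) ℂ)) :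
    commutatorL X ρ ∈ tangentVectors (unitaryOrbit ρ₀) ρ := by
  let U : ℝ → Matrix (Fin n) (Fin n) ℂ := fun t => NormedSpace.exp (t • X)
  have hU : ∀ t, U t ∈ Matrix.unitaryGroup (Fin n) ℂ := fun t =>
    let _ : NormedAlgebra ℚ (Matrix (Fin n) (Fin n) ℂ) := NormedAlgebra.restrictScalars ℚ ℝ _
    NormedSpace.exp_mem_unitary_of_mem_skewAdjoint (skewAdjoint.smul_mem t hX)
  have hsmooth : ContDiff ℝ ∞ U :=
    (contDiff_iff_contDiffAt.2 fun A => (NormedSpace.exp_analytic (𝕂 := ℝ) A).contDiffAt).comp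
      (contDiff_id.smul contDiff_const)
  have hderiv : HasDerivAt U (X * U 0) 0 := hasDerivAt_exp_smul_const' X (0 : ℝ)
  have hU₀ : U 0 = 1 := by simp [U]
  refine ⟨1, one_pos, fun t => U t * ρ * star (U t), ?_,
    fun t _ => conjStarAlgAut_mem_unitaryOrbit ⟨U t, hU t⟩ hρ, by simp [hU₀], ?_⟩
  · exact ((hsmooth.mul contDiff_const).mul
      ((starL' ℝ : Matrix (Fin n) (Fin n) ℂ ≃L[ℝ] _).contDiff.comp hsmooth)).contDiffOn
  · simpa [hU₀] using hasDerivAt_mul_mul_star hX hderiv ρ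

theorem trace_commutator_mul {ι R : Type*} [Fintype ι] [CommRing R] (X ρ θ : Matrix ι ι R) :
    ((X * ρ - ρ * X) * θ).trace = (X * (ρ * θ - θ * ρ)).trace := by
  rw [sub_mul, mul_sub, Matrix.trace_sub, Matrix.trace_sub,
    mul_assoc ρ, Matrix.trace_mul_comm ρ, mul_assoc, mul_assoc]

open scoped ComplexOrder in
/-- The test direction is `[X, ρ]` with `X = [ρ, θ]`, along which the cost has derivative
`tr (X²) = -‖X‖²`. -/
theorem commute_of_mem_criticalPointsOn (hρ₀ : ρ₀.IsHermitian) (hθ : θ.IsHermitian)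
    (h : ρ ∈ criticalPointsOn (cost θ) (unitaryOrbit ρ₀)) : Commute ρ θ := by
  obtain ⟨hρ, hv⟩ := mem_criticalPointsOn_cost_iff.1 h
  have hρH : ρᴴ = ρ := isHermitian_of_mem_unitaryOrbit hρ₀ hρ
  set X := ρ * θ - θ * ρ with hXdef
  have hX : Xᴴ = -X := by
    rw [hXdef, Matrix.conjTranspose_sub, Matrix.conjTranspose_mul,
      Matrix.conjTranspose_mul, hρH, hθ.eq, neg_sub]
  have hre : (Matrix.trace (Xᴴ * X)).re = 0 := by
    have hcost := hv _ (commutator_mem_tangentVectors hρ hX)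
    rw [cost, commutatorL_apply, trace_commutator_mul] at hcost
    rw [hX, neg_mul, Matrix.trace_neg, Complex.neg_re, hcost, neg_zero]
  have hnonneg : 0 ≤ Matrix.trace (Xᴴ * X) :=
    (Matrix.posSemidef_conjTranspose_mul_self X).trace_nonneg
  have htrace : Matrix.trace (Xᴴ * X) = 0 := Complex.ext hre (Complex.le_def.1 hnonneg).2.symm
  exact sub_eq_zero.1 (Matrix.trace_conjTranspose_mul_self_eq_zero_iff.1 htrace)

theorem hasDerivAt_trace_pow {ι : Type*} [Fintype ι] [DecidableEq ι] {γ : ℝ → Matrix ι ι ℂ}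
    {v : Matrix ι ι ℂ} {t : ℝ} (hγ : HasDerivAt γ v t) (k : ℕ) :
    HasDerivAt (fun s => (γ s ^ (k + 1)).trace) ((k + 1) * (γ t ^ k * v).trace) t := by
  have h := (LinearMap.toContinuousLinearMap
    (Matrix.traceLinearMap ι ℝ ℂ)).hasFDerivAt.comp_hasDerivAt t (hγ.fun_pow' (k + 1))
  refine h.congr_deriv ?_
  have hterm : ∀ i ∈ Finset.range (k + 1),
      (γ t ^ (k - i) * v * γ t ^ i).trace = (γ t ^ k * v).trace := fun i hi => by
    rw [Matrix.trace_mul_comm, ← mul_assoc, ← pow_add,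
      Nat.add_sub_cancel' (Nat.lt_succ_iff.1 (Finset.mem_range.1 hi))]
  change (∑ i ∈ Finset.range (k + 1), γ t ^ (k - i) * v * γ t ^ i).trace = _
  rw [Matrix.trace_sum, Finset.sum_congr rfl hterm, Finset.sum_const, Finset.card_range,
    nsmul_eq_mul, Nat.cast_add_one]

theorem trace_pow_mul_eq_zero_of_mem_tangentVectors (hv : v ∈ tangentVectors (unitaryOrbit ρ₀) ρ)
    (k : ℕ) : (ρ ^ k * v).trace = 0 := by
  obtain ⟨ε, hε, γ, -, hγ, rfl, hγv⟩ := hv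
  have hconst : (fun s => (γ s ^ (k + 1)).trace) =ᶠ[𝓝 0] fun _ => (ρ₀ ^ (k + 1)).trace := by
    filter_upwards [Ioo_mem_nhds (neg_lt_zero.2 hε) hε] with t ht
    obtain ⟨U, hU⟩ := mem_unitaryOrbit_iff.1 (hγ t ht)
    rw [hU, ← map_pow, trace_conjStarAlgAut]
  have h := (hasDerivAt_trace_pow hγv k).unique
    ((hasDerivAt_const _ _).congr_of_eventuallyEq hconst)
  exact (mul_eq_zero.1 h).resolve_left k.cast_add_one_ne_zero

theorem trace_aeval_mul_eq_zero_of_mem_tangentVectors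
    (hv : v ∈ tangentVectors (unitaryOrbit ρ₀) ρ) (p : Polynomial ℂ) :
    (Polynomial.aeval ρ p * v).trace = 0 := by
  rw [Polynomial.aeval_eq_sum_range, Finset.sum_mul, Matrix.trace_sum]
  refine Finset.sum_eq_zero fun k _ => ?_
  rw [smul_mul_assoc, Matrix.trace_smul, trace_pow_mul_eq_zero_of_mem_tangentVectors hv, smul_zero]

end CriticalPointsCommute

section Eigenbasis

variable {ι 𝕜 : Type*} [Fintype ι] [DecidableEq ι] [RCLike 𝕜] {A B : Matrix ι ι 𝕜}

/-- The matrix with the eigenvectors of the Hermitian matrix `A` and with eigenvalues `d`, as an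
algebra homomorphism in `d`. -/
noncomputable def eigenbasisDiagonal (hA : A.IsHermitian) : (ι → 𝕜) →ₐ[𝕜] Matrix ι ι 𝕜 :=
  ((Unitary.conjStarAlgAut 𝕜 _ hA.eigenvectorUnitary).toAlgEquiv : _ →ₐ[𝕜] _).comp
    (Matrix.diagonalAlgHom 𝕜)

theorem eigenbasisDiagonal_apply (hA : A.IsHermitian) (d : ι → 𝕜) :
    eigenbasisDiagonal hA d =
      Unitary.conjStarAlgAut 𝕜 _ hA.eigenvectorUnitary (Matrix.diagonal d) := rfl

theorem eigenbasisDiagonal_eigenvalues (hA : A.IsHermitian) :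
    eigenbasisDiagonal hA (RCLike.ofReal ∘ hA.eigenvalues) = A :=
  hA.spectral_theorem.symm

theorem eigenbasisDiagonal_injective (hA : A.IsHermitian) :
    Function.Injective (eigenbasisDiagonal hA) :=
  (Unitary.conjStarAlgAut 𝕜 _ hA.eigenvectorUnitary).injective.comp Matrix.diagonal_injective

theorem charpoly_eigenbasisDiagonal (hA : A.IsHermitian) (d : ι → 𝕜) :
    (eigenbasisDiagonal hA d).charpoly = (Matrix.diagonal d).charpoly :=
  charpoly_conjStarAlgAut hA.eigenvectorUnitary (Matrix.diagonal d)

theorem isHermitian_eigenbasisDiagonal (hA : A.IsHermitian) (d : ι → ℝ) :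
    (eigenbasisDiagonal hA (RCLike.ofReal ∘ d)).IsHermitian :=
  Matrix.isHermitian_mul_mul_conjTranspose _ <| Matrix.isHermitian_diagonal_of_self_adjoint _ <|
    funext fun i => RCLike.conj_ofReal (d i)

theorem eq_diagonal_of_commute_diagonal {R : Type*} [CommRing R] [NoZeroDivisors R] {d : ι → R}
    (hd : Function.Injective d) {M : Matrix ι ι R} (h : Commute (Matrix.diagonal d) M) :
    M = Matrix.diagonal M.diag := by
  ext i j
  rcases eq_or_ne i j with rfl | hij
  · simp
  have hentry : d i * M i j = M i j * d j := by
    simpa only [Matrix.diagonal_mul, Matrix.mul_diagonal] using congrFun (congrFun h.eq i) j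
  rw [Matrix.diagonal_apply_ne _ hij]
  have hprod : (d i - d j) * M i j = 0 := by rw [sub_mul, hentry, mul_comm, sub_self]
  exact (mul_eq_zero.1 hprod).resolve_left (sub_ne_zero.2 (hd.ne hij))

theorem exists_eq_eigenbasisDiagonal_of_commute (hA : A.IsHermitian)
    (hinj : Function.Injective hA.eigenvalues) (h : Commute A B) :
    ∃ d, B = eigenbasisDiagonal hA d := by
  let Φ := Unitary.conjStarAlgAut 𝕜 (Matrix ι ι 𝕜) hA.eigenvectorUnitary
  have hcomm : Commute (Matrix.diagonal (RCLike.ofReal ∘ hA.eigenvalues)) (Φ.symm B) := by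
    have := h.map Φ.symm
    rwa [(StarAlgEquiv.symm_apply_eq Φ).2 hA.spectral_theorem] at this
  refine ⟨(Φ.symm B).diag, ?_⟩
  rw [eigenbasisDiagonal_apply,
    ← eq_diagonal_of_commute_diagonal (RCLike.ofReal_injective.comp hinj) hcomm]
  exact (Φ.apply_symm_apply B).symm

/-- Lagrange interpolation of the eigenvalues of `B` at those of `A`. -/
theorem exists_eq_aeval_of_commute (hA : A.IsHermitian) (hinj : Function.Injective hA.eigenvalues)
    (h : Commute A B) : ∃ p : Polynomial 𝕜, B = Polynomial.aeval A p := by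
  obtain ⟨d, rfl⟩ := exists_eq_eigenbasisDiagonal_of_commute hA hinj h
  obtain ⟨p, hp⟩ := (Polynomial.exists_eval_eq_iff (RCLike.ofReal ∘ hA.eigenvalues) d).2
    fun i j hij => congrArg d (hinj (RCLike.ofReal_injective hij))
  have hd : d = Polynomial.aeval (RCLike.ofReal ∘ hA.eigenvalues) p := funext fun i => by
    rw [Polynomial.aeval_pi_apply₂, Polynomial.coe_aeval_eq_eval, hp]
  exact ⟨p, by rw [hd, ← Polynomial.aeval_algHom_apply, eigenbasisDiagonal_eigenvalues]⟩

omit [DecidableEq ι] in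
theorem exists_perm_eq_comp_of_map_univ_eq {α : Type*} {f g : ι → α}
    (h : Multiset.map f Finset.univ.val = Multiset.map g Finset.univ.val) :
    ∃ π : Equiv.Perm ι, f = g ∘ π := by
  classical
  have hcard : ∀ a, Fintype.card {i // f i = a} = Fintype.card {i // g i = a} := fun a => by
    have := congrArg (Multiset.count a) h
    simp only [Multiset.count_map, eq_comm (a := a)] at this
    simpa only [Fintype.card_subtype, Finset.card_def, Finset.filter_val] using this
  let e := fun a => Fintype.equivOfCardEq (hcard a)
  exact ⟨Equiv.ofFiberEquiv e, funext fun i => (Equiv.ofFiberEquiv_map e i).symm⟩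

theorem charpoly_diagonal_eq_iff {R : Type*} [CommRing R] [IsDomain R] {d e : ι → R} :
    (Matrix.diagonal d).charpoly = (Matrix.diagonal e).charpoly ↔
      ∃ π : Equiv.Perm ι, d = e ∘ π := by
  have hroots : ∀ d : ι → R, (Matrix.diagonal d).charpoly.roots =
      Multiset.map d Finset.univ.val := fun d => by
    rw [Matrix.charpoly_diagonal,
      ← Polynomial.roots_multiset_prod_X_sub_C (Multiset.map d Finset.univ.val), Multiset.map_map]
    rfl
  constructor
  · intro h
    exact exists_perm_eq_comp_of_map_univ_eq (by rw [← hroots, ← hroots, h])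
  · rintro ⟨π, rfl⟩
    simp only [Matrix.charpoly_diagonal]
    exact Equiv.prod_comp π fun i => Polynomial.X - Polynomial.C (e i)

end Eigenbasis

section Classification

variable {n : ℕ} {ρ₀ θ ρ : Matrix (Fin n) (Fin n) ℂ}

theorem mem_criticalPointsOn_cost_unitaryOrbit_iff (hρ₀ : ρ₀.IsHermitian) (hθ : θ.IsHermitian)
    (hsimple : Function.Injective hρ₀.eigenvalues) :
    ρ ∈ criticalPointsOn (cost θ) (unitaryOrbit ρ₀) ↔ ρ ∈ unitaryOrbit ρ₀ ∧ Commute ρ θ := by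
  refine ⟨fun h => ⟨h.1, commute_of_mem_criticalPointsOn hρ₀ hθ h⟩, fun ⟨hρ, hcomm⟩ =>
    mem_criticalPointsOn_cost_iff.2 ⟨hρ, fun v hv => ?_⟩⟩
  have hρH := isHermitian_of_mem_unitaryOrbit hρ₀ hρ
  have heig : hρH.eigenvalues = hρ₀.eigenvalues :=
    (hρH.eigenvalues_eq_eigenvalues_iff hρ₀).2 (charpoly_eq_of_mem_unitaryOrbit hρ)
  obtain ⟨p, rfl⟩ := exists_eq_aeval_of_commute hρH (heig ▸ hsimple) hcomm
  rw [cost, Matrix.trace_mul_comm, trace_aeval_mul_eq_zero_of_mem_tangentVectors hv,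
    Complex.zero_re]

theorem mem_unitaryOrbit_and_commute_iff (hρ₀ : ρ₀.IsHermitian) (hθ : θ.IsHermitian)
    (hsimple : Function.Injective hθ.eigenvalues) :
    ρ ∈ unitaryOrbit ρ₀ ∧ Commute ρ θ ↔
      ∃ π : Equiv.Perm (Fin n),
        eigenbasisDiagonal hθ (RCLike.ofReal ∘ hρ₀.eigenvalues ∘ π) = ρ := by
  have hcharpoly : ρ₀.charpoly = (Matrix.diagonal (RCLike.ofReal ∘ hρ₀.eigenvalues)).charpoly := by
    rw [← charpoly_eigenbasisDiagonal hρ₀, eigenbasisDiagonal_eigenvalues]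
  constructor
  · rintro ⟨hρ, hcomm⟩
    obtain ⟨d, rfl⟩ := exists_eq_eigenbasisDiagonal_of_commute hθ hsimple hcomm.symm
    have h := charpoly_eq_of_mem_unitaryOrbit hρ
    rw [charpoly_eigenbasisDiagonal, hcharpoly] at h
    obtain ⟨π, rfl⟩ := charpoly_diagonal_eq_iff.1 h
    exact ⟨π, rfl⟩
  · rintro ⟨π, rfl⟩
    refine ⟨mem_unitaryOrbit_of_charpoly_eq (isHermitian_eigenbasisDiagonal hθ _) hρ₀ ?_, ?_⟩
    · rw [charpoly_eigenbasisDiagonal, hcharpoly]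
      exact charpoly_diagonal_eq_iff.2 ⟨π, rfl⟩
    · have h := (Commute.all (RCLike.ofReal ∘ hρ₀.eigenvalues ∘ π)
        (RCLike.ofReal ∘ hθ.eigenvalues : Fin n → ℂ)).map (eigenbasisDiagonal hθ)
      rwa [eigenbasisDiagonal_eigenvalues] at h

theorem exists_injective_range_eq_monotone {α β : Type*} [LinearOrder β] {k : ℕ} {c : Fin k → α}
    (hc : Function.Injective c) (f : α → β) :
    ∃ c' : Fin k → α, Function.Injective c' ∧ Set.range c' = Set.range c ∧ Monotone (f ∘ c') :=
  ⟨c ∘ Tuple.sort (f ∘ c), hc.comp (Tuple.sort (f ∘ c)).injective, EquivLike.range_comp _ _,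
    Tuple.monotone_sort (f ∘ c)⟩

theorem exists_monotone_enum_criticalPointsOn (hρ₀ : ρ₀.IsHermitian) (hθ : θ.IsHermitian)
    (hρ₀simple : Function.Injective hρ₀.eigenvalues)
    (hθsimple : Function.Injective hθ.eigenvalues) :
    ∃ ρc : Fin (Nat.factorial n) → Matrix (Fin n) (Fin n) ℂ,
      Function.Injective ρc ∧ Set.range ρc = criticalPointsOn (cost θ) (unitaryOrbit ρ₀) ∧
      Monotone (cost θ ∘ ρc) := by
  let crit : Equiv.Perm (Fin n) → Matrix (Fin n) (Fin n) ℂ := fun π =>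
    eigenbasisDiagonal hθ (RCLike.ofReal ∘ hρ₀.eigenvalues ∘ π)
  have hcrit : Set.range crit = criticalPointsOn (cost θ) (unitaryOrbit ρ₀) := Set.ext fun ρ => by
    rw [mem_criticalPointsOn_cost_unitaryOrbit_iff hρ₀ hθ hρ₀simple,
      mem_unitaryOrbit_and_commute_iff hρ₀ hθ hθsimple, Set.mem_range]
  have hinj : Function.Injective crit := (eigenbasisDiagonal_injective hθ).comp <|
    RCLike.ofReal_injective.comp_left.comp <| hρ₀simple.comp_left.comp DFunLike.coe_injective
  let e : Fin (Nat.factorial n) ≃ Equiv.Perm (Fin n) :=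
    (Fintype.equivFinOfCardEq (by rw [Fintype.card_perm, Fintype.card_fin])).symm
  obtain ⟨ρc, hρc, hrange, hmono⟩ :=
    exists_injective_range_eq_monotone (hinj.comp e.injective) (cost θ)
  exact ⟨ρc, hρc, by rw [hrange, EquivLike.range_comp, hcrit], hmono⟩

end Classification

end QuantumControl

theorem mainTheorem4_general (n : ℕ) (T : ℝ) (hT : 0 ≤ T)
    (H₀ H₁ ρ₀ θ : Matrix (Fin n) (Fin n) ℂ)
    (hH₀ : H₀ᴴ = -H₀) (hH₁ : H₁ᴴ = -H₁)
    (hρ₀ : ρ₀.IsHermitian) (hθ : θ.IsHermitian)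
    (hρ₀simple : Function.Injective hρ₀.eigenvalues)
    (hθsimple : Function.Injective hθ.eigenvalues)
    (hreg : ∀ u ∈ criticalPoints (controlCost H₀ H₁ ρ₀ θ T), IsRegularControl H₀ H₁ ρ₀ T u) :
    ((∀ u : Control T, ∃ ρ, IsTrajectory H₀ H₁ ρ₀ T u ρ) ∧
      (∀ (u : Control T) (ρ : ℝ → Matrix (Fin n) (Fin n) ℂ),
        IsTrajectory H₀ H₁ ρ₀ T u ρ → ρ T = endPoint H₀ H₁ ρ₀ T u) ∧
      (∀ u : Control T, endPoint H₀ H₁ ρ₀ T u ∈ unitaryOrbit ρ₀) ∧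
      ContDiff ℝ ∞ (endPoint H₀ H₁ ρ₀ T)) ∧
    ∃ ρc : Fin (Nat.factorial n) → Matrix (Fin n) (Fin n) ℂ,
      Function.Injective ρc ∧
      Set.range ρc = criticalPointsOn (cost θ) (unitaryOrbit ρ₀) ∧
      Monotone (fun i => cost θ (ρc i)) ∧
      criticalPoints (controlCost H₀ H₁ ρ₀ θ T) = ⋃ i, fibre H₀ H₁ ρ₀ T (ρc i) ∧
      Pairwise (fun i j => Disjoint (fibre H₀ H₁ ρ₀ T (ρc i)) (fibre H₀ H₁ ρ₀ T (ρc j))) ∧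
      ∀ i, IsSubmanifoldOfCodim (orbitDim ρ₀) (fibre H₀ H₁ ρ₀ T (ρc i)) ∧
        ∀ u ∈ fibre H₀ H₁ ρ₀ T (ρc i),
          tangentVectors (fibre H₀ H₁ ρ₀ T (ρc i)) u =
            {v : Control T | fderiv ℝ (endPoint H₀ H₁ ρ₀ T) u v = 0} := by
  obtain ⟨ρc, hinj, hrange, hmono⟩ :=
    exists_monotone_enum_criticalPointsOn hρ₀ hθ hρ₀simple hθsimple
  have hsmooth := contDiff_endPoint hT H₀ H₁ ρ₀
  have hrank := finrank_range_fderiv_endPoint_le (ρ₀ := ρ₀) hT hH₀ hH₁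
  have hcrit : criticalPoints (controlCost H₀ H₁ ρ₀ θ T) = ⋃ i, fibre H₀ H₁ ρ₀ T (ρc i) := by
    rw [criticalPoints_controlCost hT hH₀ hH₁ hreg, ← hrange]
    ext u
    simp [fibre, eq_comm]
  have hregular : ∀ i, ∀ u ∈ fibre H₀ H₁ ρ₀ T (ρc i), IsRegularControl H₀ H₁ ρ₀ T u :=
    fun i u hu => hreg u (hcrit ▸ Set.mem_iUnion_of_mem i hu)
  refine ⟨⟨exists_isTrajectory hT, fun u ρ h => isTrajectory_apply_eq_endPoint hT h,
    endPoint_mem_unitaryOrbit hT ρ₀ hH₀ hH₁, hsmooth⟩, ρc, hinj, hrange, hmono, hcrit,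
    fun i j hij => Set.disjoint_left.2 fun u hi hj => hij (hinj (hi.symm.trans hj)),
    fun i => ⟨isSubmanifoldOfCodim_fibre_of_finrank_range_le hsmooth hrank (hregular i), ?_⟩⟩
  intro u hu
  have h := tangentVectors_fibre_of_finrank_range_le hsmooth hrank (hregular i u hu)
  rwa [show endPoint H₀ H₁ ρ₀ T u = ρc i from hu] at h

theorem mainTheorem4 (n : ℕ) (T : ℝ) (hT : 0 < T)
    (H₀ H₁ ρ₀ θ : Matrix (Fin n) (Fin n) ℂ)
    (hH₀ : H₀ᴴ = -H₀) (hH₀tr : H₀.trace = 0)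
    (hH₁ : H₁ᴴ = -H₁) (hH₁tr : H₁.trace = 0)
    (hρ₀ : ρ₀.IsHermitian) (hθ : θ.IsHermitian)
    (hρ₀simple : Function.Injective hρ₀.eigenvalues)
    (hθsimple : Function.Injective hθ.eigenvalues)
    (hreg : ∀ u : Control T, IsRegularControl H₀ H₁ ρ₀ T u) :
    ((∀ u : Control T, ∃ ρ, IsTrajectory H₀ H₁ ρ₀ T u ρ) ∧
      (∀ (u : Control T) (ρ : ℝ → Matrix (Fin n) (Fin n) ℂ),
        IsTrajectory H₀ H₁ ρ₀ T u ρ → ρ T = endPoint H₀ H₁ ρ₀ T u) ∧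
      (∀ u : Control T, endPoint H₀ H₁ ρ₀ T u ∈ unitaryOrbit ρ₀) ∧
      ContDiff ℝ ∞ (endPoint H₀ H₁ ρ₀ T)) ∧
    ∃ ρc : Fin (Nat.factorial n) → Matrix (Fin n) (Fin n) ℂ,
      Function.Injective ρc ∧
      Set.range ρc = criticalPointsOn (cost θ) (unitaryOrbit ρ₀) ∧
      Monotone (fun i => cost θ (ρc i)) ∧
      criticalPoints (controlCost H₀ H₁ ρ₀ θ T) = ⋃ i, fibre H₀ H₁ ρ₀ T (ρc i) ∧
      Pairwise (fun i j => Disjoint (fibre H₀ H₁ ρ₀ T (ρc i)) (fibre H₀ H₁ ρ₀ T (ρc j))) ∧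
      ∀ i, IsSubmanifoldOfCodim (orbitDim ρ₀) (fibre H₀ H₁ ρ₀ T (ρc i)) ∧
        ∀ u ∈ fibre H₀ H₁ ρ₀ T (ρc i),
          tangentVectors (fibre H₀ H₁ ρ₀ T (ρc i)) u =
            {v : Control T | fderiv ℝ (endPoint H₀ H₁ ρ₀ T) u v = 0} :=
  mainTheorem4_general n T hT.le H₀ H₁ ρ₀ θ hH₀ hH₁ hρ₀ hθ hρ₀simple hθsimple fun u _ => hreg u
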